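/- All graphs are finite and simple. A graph is \emph{outerplanar} if it has a crossing-free drawing in the plane (vertices are distinct points, edges are simple arcs joining their ends that contain no other vertices and meet each other only in common ends) in which every vertex lies on the boundary of the outer (unbounded) face. The \emph{vertex-edge incidence poset} $P_G$ of a graph $G=(V,E)$ is the poset on the disjoint union of $V$ and $E$ in which the only strict relations are $v<e$ for $v\in V$, $e\in E$ with $v\in e$; its comparability graph has ground set $V\sqcup E$, two distinct elements being adjacent if and only if they are comparable (equivalently, it is the graph obtained from $G$ by subdividing every edge once). A graph is a \emph{unit grid intersection graph} (UGIG) if it is the intersection graph of a family of closed horizontal and vertical segments in the plane, all of the same positive length, such that distinct parallel segments of the family do not intersect. \textbf{Proposition.} If $G$ is an outerplanar graph, then (the comparability graph of) $P_G$ is a unit grid intersection graph. -/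

import Mathlib

/-! ### Outerplanar graphs -/

/-- A crossing-free drawing of a graph in the plane: vertices are distinct points, every edge is a
simple arc joining its two ends, an edge contains no vertex other than its ends, and two distinct
edges meet only in common ends. -/
structure PlaneDrawing {V : Type*} (G : SimpleGraph V) where
  /-- the point that represents a vertex -/
  point : V → ℝ × ℝ
  /-- the set of points of the arc that represents an edge -/
  arc : G.edgeSet → Set (ℝ × ℝ)
  point_injective : Function.Injective point
  arc_spec : ∀ (u v : V) (h : G.Adj u v), ∃ γ : Path (point u) (point v),
    Function.Injective γ ∧ Set.range γ = arc ⟨s(u, v), h⟩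
  mem_of_point_mem_arc : ∀ (v : V) (e : G.edgeSet), point v ∈ arc e → v ∈ (e : Sym2 V)
  arc_inter_arc : ∀ e f : G.edgeSet, e ≠ f → ∀ p ∈ arc e ∩ arc f,
    ∃ v : V, v ∈ (e : Sym2 V) ∧ v ∈ (f : Sym2 V) ∧ p = point v

namespace PlaneDrawing

variable {V : Type*} {G : SimpleGraph V}

/-- All points of the plane that are covered by the drawing. -/
def support (D : PlaneDrawing G) : Set (ℝ × ℝ) :=
  Set.range D.point ∪ ⋃ e, D.arc e

/-- The faces of a drawing are the connected components of the complement of its support. -/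
def IsFace (D : PlaneDrawing G) (F : Set (ℝ × ℝ)) : Prop :=
  ∃ x ∈ D.supportᶜ, F = connectedComponentIn D.supportᶜ x

/-- The outer face is the unbounded face. -/
def IsOuterFace (D : PlaneDrawing G) (F : Set (ℝ × ℝ)) : Prop :=
  D.IsFace F ∧ ¬ Bornology.IsBounded F

end PlaneDrawing

/-- A graph is outerplanar if it has a crossing-free drawing in the plane in which all vertices lie
on the boundary of the outer face. -/
def IsOuterplanar {V : Type*} (G : SimpleGraph V) : Prop :=
  ∃ (D : PlaneDrawing G) (F : Set (ℝ × ℝ)), D.IsOuterFace F ∧ ∀ v : V, D.point v ∈ frontier F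

/-! ### The vertex-edge incidence poset -/

/-- The ground set of the vertex-edge incidence poset of `G`: its vertices and its edges. -/
inductive IncidencePoset {V : Type*} (G : SimpleGraph V) where
  | vertex (v : V) : IncidencePoset G
  | edge (e : G.edgeSet) : IncidencePoset G

namespace IncidencePoset

variable {V : Type*} {G : SimpleGraph V}

/-- `a ≤ b` if `a = b`, or `a` is a vertex and `b` is an edge that is incident to it. -/
def Le : IncidencePoset G → IncidencePoset G → Prop
  | vertex u, vertex v => u = v
  | vertex u, edge e => u ∈ (e : Sym2 V)
  | edge _, vertex _ => False
  | edge e, edge f => e = f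

instance : PartialOrder (IncidencePoset G) where
  le := Le
  le_refl a := by cases a <;> simp [Le]
  le_trans a b c := by
    cases a <;> cases b <;> cases c <;> simp only [Le] <;> intro h₁ h₂ <;> simp_all
  le_antisymm a b := by
    cases a <;> cases b <;> simp only [Le] <;> intro h₁ h₂ <;> simp_all

end IncidencePoset

/-- The comparability graph of a poset: distinct elements are adjacent if they are comparable. -/
def comparabilityGraph (P : Type*) [PartialOrder P] : SimpleGraph P where
  Adj u v := u ≠ v ∧ (u ≤ v ∨ v ≤ u)
  symm := ⟨fun _ _ h => ⟨h.1.symm, h.2.symm⟩⟩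
  loopless := ⟨fun _ h => h.1 rfl⟩

/-! ### Unit grid intersection graphs -/

/-- A (non-degenerate, closed) horizontal or vertical segment in the plane, given by its left
respectively lower endpoint `(x, y)` and its length. -/
structure GridSegment where
  horizontal : Bool
  x : ℝ
  y : ℝ
  length : ℝ
  length_pos : 0 < length

/-- The set of points of a horizontal or vertical segment. -/
def GridSegment.toSet (s : GridSegment) : Set (ℝ × ℝ) :=
  if s.horizontal then Set.Icc s.x (s.x + s.length) ×ˢ {s.y}
  else {s.x} ×ˢ Set.Icc s.y (s.y + s.length)

/-- A grid intersection representation of a graph: an assignment of horizontal and vertical segments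
to the vertices, such that two vertices are adjacent if and only if their segments intersect, and
parallel segments do not intersect. -/
structure GridRepresentation {W : Type*} (H : SimpleGraph W) where
  seg : W → GridSegment
  adj_iff : ∀ u v : W, u ≠ v → (H.Adj u v ↔ ((seg u).toSet ∩ (seg v).toSet).Nonempty)
  parallel_disjoint : ∀ u v : W, u ≠ v → (seg u).horizontal = (seg v).horizontal →
    Disjoint (seg u).toSet (seg v).toSet

/-- A unit grid intersection graph has a grid intersection representation in which all segments have
the same length. -/
def IsUGIG {W : Type*} (H : SimpleGraph W) : Prop :=
  ∃ R : GridRepresentation H, ∀ u v : W, (R.seg u).length = (R.seg v).length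

/-! An outerplanar graph has a linear vertex order in which no two edges cross, and breadth-first
levels in such an order give explicit coordinates. The passage from the drawing to the order goes
through excluded minors.

Minors: a new vertex placed in the outer face can be connected to every vertex without crossing the
drawing. A `K₄`- or `K₂,₃`-minor would therefore yield connections for `K₅` or `K₃,₃` in which
independent edges are disjoint (`PlaneDrawing.exists_connections`). These are excluded by a parity
count: for disjoint paths γ and δ the map (s, t) ↦ γ(s) − δ(t) has a logarithm on the square, so its
increments around the boundary cancel. This gives one integer equation in turning numbers for each
pair of independent edges, and the equations are inconsistent modulo 2 (`exists_turning_numbers`).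

Order: `OuterMinorFree.exists_layout` proves by induction on D that D has a crossing-free order in
which no edge passes over a neighbour of a given connected set W outside D. The exposed neighbours
allow partial orders to be glued at a vertex.

Coordinates: after adding the edges between consecutive vertices the graph is connected, and the
level of a vertex is its distance from the first one. A vertex of level k gets a vertical segment at
about (k, −k), displaced by (ξ, η). An edge whose lower level is k gets a horizontal segment
starting at about (k, −k), which can meet only segments of levels k and k + 1. Displacements that
follow the order within each level, and place each vertex next to a suitable parent, leave exactly
the two ends of the edge (`IsLeveled.hasUnitGridCoordinates`). -/

/-! ### Logarithms along paths and a parity obstruction to planarity -/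

open unitInterval

/-- A nowhere vanishing continuous function on the unit square has a continuous logarithm. -/
theorem exists_continuous_log_square {g : I × I → ℂ} (hg : Continuous g) (h0 : ∀ z, g z ≠ 0) :
    ∃ f : I × I → ℂ, Continuous f ∧ ∀ z, Complex.exp (f z) = g z := by
  let r : ℝ × ℝ → I × I := fun z =>
    (Set.projIcc 0 1 zero_le_one z.1, Set.projIcc 0 1 zero_le_one z.2)
  have hr : Continuous r :=
    (continuous_projIcc.comp continuous_fst).prodMk (continuous_projIcc.comp continuous_snd)
  obtain ⟨f, ⟨-, hf⟩, -⟩ := Complex.isCoveringMapOn_exp.existsUnique_continuousMap_lifts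
    ⟨g ∘ r, hg.comp hr⟩ (a₀ := (0, 0)) (Complex.exp_log (h0 _)) (fun a => by simp [h0])
  refine ⟨fun z => f (z.1, z.2), by fun_prop, fun z => ?_⟩
  have := congrFun hf ((z.1 : ℝ), (z.2 : ℝ))
  simpa [r] using this

/-- Two continuous logarithms of proportional functions on the unit interval have the same
increment. -/
theorem log_increment_eq {f g : I → ℂ} (hf : Continuous f) (hg : Continuous g) {c : ℂ}
    (h : ∀ t, Complex.exp (f t) = c * Complex.exp (g t)) : f 1 - f 0 = g 1 - g 0 := by
  have hc : c = Complex.exp (f 0 - g 0) := by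
    rw [Complex.exp_sub, h 0, mul_div_assoc, div_self (Complex.exp_ne_zero _), mul_one]
  have key : f = fun t => g t + (f 0 - g 0) := by
    -- Both sides lift the same function through the covering `Complex.exp` and agree at 0.
    refine Complex.isCoveringMap_exp.eq_of_comp_eq hf (by fun_prop) ?_ 0 (by ring)
    ext t
    simp only [Function.comp_apply]
    rw [h t, Complex.exp_add, hc, mul_comm]
  rw [congrFun key 1]
  ring

/-- For two paths with disjoint images, the logarithm increments along the four sides of the square
on which the difference of the paths is defined add up to zero. -/
theorem log_increment_square {a c b d : ℂ} (γ : Path a c) (δ : Path b d)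
    (hd : Disjoint (Set.range γ) (Set.range δ)) {f₁ f₂ f₃ f₄ : I → ℂ}
    (hf₁ : Continuous f₁) (hf₂ : Continuous f₂) (hf₃ : Continuous f₃) (hf₄ : Continuous f₄)
    (h₁ : ∀ t, Complex.exp (f₁ t) = γ t - b) (h₂ : ∀ t, Complex.exp (f₂ t) = γ t - d)
    (h₃ : ∀ t, Complex.exp (f₃ t) = δ t - c) (h₄ : ∀ t, Complex.exp (f₄ t) = δ t - a) :
    (f₁ 1 - f₁ 0) - (f₂ 1 - f₂ 0) + (f₃ 1 - f₃ 0) - (f₄ 1 - f₄ 0) = 0 := by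
  obtain ⟨F, hF, hexp⟩ := exists_continuous_log_square
    (g := fun z : I × I => γ z.1 - δ z.2) (by fun_prop) (fun z => sub_ne_zero.2 fun h =>
      Set.disjoint_left.1 hd ⟨z.1, rfl⟩ ⟨z.2, h.symm⟩)
  have e₁ := log_increment_eq hf₁ (g := fun t => F (t, 0)) (by fun_prop) (c := 1)
    (fun t => by rw [hexp, h₁]; simp)
  have e₂ := log_increment_eq hf₂ (g := fun t => F (t, 1)) (by fun_prop) (c := 1)
    (fun t => by rw [hexp, h₂]; simp)
  have e₃ := log_increment_eq hf₃ (g := fun t => F (1, t)) (by fun_prop) (c := -1)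
    (fun t => by rw [hexp, h₃]; simp)
  have e₄ := log_increment_eq hf₄ (g := fun t => F (0, t)) (by fun_prop) (c := -1)
    (fun t => by rw [hexp, h₄]; simp)
  rw [e₁, e₂, e₃, e₄]
  ring

theorem exists_continuous_log_path {v w u : ℂ} (γ : Path v w) (hu : u ∉ Set.range γ) :
    ∃ f : I → ℂ, Continuous f ∧ ∀ t, Complex.exp (f t) = γ t - u := by
  obtain ⟨f, hf, h⟩ := exists_continuous_log_square (g := fun z : I × I => γ z.1 - u)
    (by fun_prop) (fun z => sub_ne_zero.2 fun h => hu ⟨z.1, h⟩)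
  exact ⟨fun t => f (t, 0), by fun_prop, fun t => h (t, 0)⟩

/-- A logarithm of `p v - p u`, chosen such that exchanging `u` and `v` changes it by `π i`. -/
noncomputable def directionLog {m : ℕ} (p : Fin m → ℂ) (u v : Fin m) : ℂ :=
  if u < v then Complex.log (p v - p u) else Complex.log (p u - p v) + Real.pi * Complex.I

/-- `1` or `-1`, depending on the order of the arguments. -/
def orderSign {m : ℕ} (u v : Fin m) : ℤ := if u < v then 1 else -1

theorem exp_directionLog {m : ℕ} {p : Fin m → ℂ} {u v : Fin m} (h : p u ≠ p v) :
    Complex.exp (directionLog p u v) = p v - p u := by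
  unfold directionLog
  split_ifs
  · exact Complex.exp_log (sub_ne_zero.2 h.symm)
  · rw [Complex.exp_add, Complex.exp_log (sub_ne_zero.2 h), Complex.exp_pi_mul_I]
    ring

theorem directionLog_sub_swap {m : ℕ} (p : Fin m → ℂ) {u v : Fin m} (h : u ≠ v) :
    directionLog p u v - directionLog p v u = -(orderSign u v : ℂ) * (Real.pi * Complex.I) := by
  unfold directionLog orderSign
  rcases lt_or_gt_of_ne h with h | h
  · simp [h, h.not_gt]
  · simp [h, h.not_gt]

/-- The parity obstruction: for points in the plane and connections between some of them such that
independent connections are disjoint, there are integers (turning numbers of a connection around a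
point) that satisfy one parity condition for every pair of independent connections. -/
theorem exists_turning_numbers {m : ℕ} (p : Fin m → ℂ) (E : Fin m → Fin m → Prop)
    (S : Fin m → Fin m → Set ℂ) (hS : ∀ i j, E i j → JoinedIn (S i j) (p i) (p j))
    (hd : ∀ a c b d, E a c → E b d → a ≠ b → a ≠ d → c ≠ b → c ≠ d → Disjoint (S a c) (S b d)) :
    ∃ n : Fin m → Fin m → Fin m → ℤ, ∀ a c b d, E a c → E b d →
      a ≠ b → a ≠ d → c ≠ b → c ≠ d →
      2 * (n b a c - n d a c + n c b d - n a b d) =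
        orderSign a b + orderSign b c + orderSign c d + orderSign d a := by
  classical
  have hint : ∀ u v w, ∃ k : ℤ, ∀ h : E v w, (∀ x ∈ S v w, x ≠ p u) → ∀ f : I → ℂ, Continuous f →
      (∀ t, Complex.exp (f t) = (hS v w h).somePath t - p u) →
      f 1 - f 0 = directionLog p u w - directionLog p u v + k * (2 * Real.pi * Complex.I) := by
    intro u v w
    by_cases h : E v w ∧ ∀ x ∈ S v w, x ≠ p u
    · obtain ⟨h, hx⟩ := h
      obtain ⟨f, hf, he⟩ := exists_continuous_log_path (u := p u) (hS v w h).somePath (by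
        rintro ⟨t, ht⟩
        exact hx _ ((hS v w h).somePath_mem t) ht)
      have hv := hx _ (hS v w h).source_mem
      have hw := hx _ (hS v w h).target_mem
      have : Complex.exp (f 1 - f 0) =
          Complex.exp (directionLog p u w - directionLog p u v) := by
        rw [Complex.exp_sub, Complex.exp_sub, exp_directionLog hv.symm, exp_directionLog hw.symm,
          he, he]
        simp
      obtain ⟨k, hk⟩ := Complex.exp_eq_exp_iff_exists_int.1 this
      refine ⟨k, fun _ _ g hg hge => ?_⟩
      rw [← hk]
      exact log_increment_eq hg hf (c := 1) (fun t => by rw [he, hge]; simp)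
    · exact ⟨0, fun h1 h2 => (h ⟨h1, h2⟩).elim⟩
  choose n hn using hint
  refine ⟨n, fun a c b d hac hbd hab had hcb hcd => ?_⟩
  have hdis := hd a c b d hac hbd hab had hcb hcd
  have ha := (hS a c hac).source_mem
  have hc := (hS a c hac).target_mem
  have hb := (hS b d hbd).source_mem
  have hd' := (hS b d hbd).target_mem
  have nb : ∀ x ∈ S a c, x ≠ p b := fun x hx h => Set.disjoint_left.1 hdis hx (h ▸ hb)
  have nd : ∀ x ∈ S a c, x ≠ p d := fun x hx h => Set.disjoint_left.1 hdis hx (h ▸ hd')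
  have nc : ∀ x ∈ S b d, x ≠ p c := fun x hx h => Set.disjoint_left.1 hdis (h ▸ hc) hx
  have na : ∀ x ∈ S b d, x ≠ p a := fun x hx h => Set.disjoint_left.1 hdis (h ▸ ha) hx
  have hγ : ∀ x ∈ Set.range (hS a c hac).somePath, x ∈ S a c := by
    rintro _ ⟨t, rfl⟩; exact (hS a c hac).somePath_mem t
  have hδ : ∀ x ∈ Set.range (hS b d hbd).somePath, x ∈ S b d := by
    rintro _ ⟨t, rfl⟩; exact (hS b d hbd).somePath_mem t
  obtain ⟨f₁, c₁, h₁⟩ := exists_continuous_log_path (u := p b) (hS a c hac).somePath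
    fun h => nb _ (hγ _ h) rfl
  obtain ⟨f₂, c₂, h₂⟩ := exists_continuous_log_path (u := p d) (hS a c hac).somePath
    fun h => nd _ (hγ _ h) rfl
  obtain ⟨f₃, c₃, h₃⟩ := exists_continuous_log_path (u := p c) (hS b d hbd).somePath
    fun h => nc _ (hδ _ h) rfl
  obtain ⟨f₄, c₄, h₄⟩ := exists_continuous_log_path (u := p a) (hS b d hbd).somePath
    fun h => na _ (hδ _ h) rfl
  have hsum := log_increment_square _ _
    (Set.disjoint_left.2 fun x h1 h2 => Set.disjoint_left.1 hdis (hγ x h1) (hδ x h2))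
    c₁ c₂ c₃ c₄ h₁ h₂ h₃ h₄
  rw [hn b a c hac nb f₁ c₁ h₁, hn d a c hac nd f₂ c₂ h₂, hn c b d hbd nc f₃ c₃ h₃,
    hn a b d hbd na f₄ c₄ h₄] at hsum
  -- The eight direction logarithms in `hsum` form four differences under exchange of arguments,
  -- each equal to ±πi. Cancelling πi leaves an equation between integers.
  have s₁ := directionLog_sub_swap p hab
  have s₂ := directionLog_sub_swap p hcb.symm
  have s₃ := directionLog_sub_swap p hcd
  have s₄ := directionLog_sub_swap p had.symm
  have hpi : (Real.pi * Complex.I : ℂ) ≠ 0 :=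
    mul_ne_zero (by exact_mod_cast Real.pi_ne_zero) Complex.I_ne_zero
  have : ((2 * (n b a c - n d a c + n c b d - n a b d) : ℤ) : ℂ) * (Real.pi * Complex.I) =
      ((orderSign a b + orderSign b c + orderSign c d + orderSign d a : ℤ) : ℂ) *
        (Real.pi * Complex.I) := by
    push_cast
    linear_combination hsum - s₁ - s₂ - s₃ - s₄
  exact_mod_cast mul_right_cancel₀ hpi this

/-- There is no drawing of `K₅` in the plane in which independent edges are disjoint. -/
theorem not_planar_K5 (p : Fin 5 → ℂ) (S : Fin 5 → Fin 5 → Set ℂ)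
    (hS : ∀ i j, i < j → JoinedIn (S i j) (p i) (p j))
    (hd : ∀ a c b d, a < c → b < d → a ≠ b → a ≠ d → c ≠ b → c ≠ d →
      Disjoint (S a c) (S b d)) : False := by
  obtain ⟨n, hn⟩ := exists_turning_numbers p (· < ·) S hS hd
  have e1 := hn 0 1 2 3 (by decide) (by decide) (by decide) (by decide) (by decide) (by decide)
  have e2 := hn 0 1 2 4 (by decide) (by decide) (by decide) (by decide) (by decide) (by decide)
  have e3 := hn 0 1 3 4 (by decide) (by decide) (by decide) (by decide) (by decide) (by decide)
  have e4 := hn 0 2 1 3 (by decide) (by decide) (by decide) (by decide) (by decide) (by decide)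
  have e5 := hn 0 2 1 4 (by decide) (by decide) (by decide) (by decide) (by decide) (by decide)
  have e6 := hn 0 2 3 4 (by decide) (by decide) (by decide) (by decide) (by decide) (by decide)
  have e7 := hn 0 3 1 2 (by decide) (by decide) (by decide) (by decide) (by decide) (by decide)
  have e8 := hn 0 3 1 4 (by decide) (by decide) (by decide) (by decide) (by decide) (by decide)
  have e9 := hn 0 3 2 4 (by decide) (by decide) (by decide) (by decide) (by decide) (by decide)
  have e10 := hn 0 4 1 2 (by decide) (by decide) (by decide) (by decide) (by decide) (by decide)
  have e11 := hn 0 4 1 3 (by decide) (by decide) (by decide) (by decide) (by decide) (by decide)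
  have e12 := hn 0 4 2 3 (by decide) (by decide) (by decide) (by decide) (by decide) (by decide)
  have e13 := hn 1 2 3 4 (by decide) (by decide) (by decide) (by decide) (by decide) (by decide)
  have e14 := hn 1 3 2 4 (by decide) (by decide) (by decide) (by decide) (by decide) (by decide)
  have e15 := hn 1 4 2 3 (by decide) (by decide) (by decide) (by decide) (by decide) (by decide)
  -- Halved, the right side is 1 if the ends of the two edges interleave and 0 otherwise.
  -- Interleaving happens once for each four of the five vertices, hence five times. Every turning
  -- number occurs in exactly two of the fifteen equations, so the sum would be both odd and even.
  simp [orderSign] at e1 e2 e3 e4 e5 e6 e7 e8 e9 e10 e11 e12 e13 e14 e15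
  omega

/-- There is no drawing of `K₃,₃` in the plane in which independent edges are disjoint. -/
theorem not_planar_K33 (p : Fin 6 → ℂ) (S : Fin 6 → Fin 6 → Set ℂ)
    (hS : ∀ i j, i < 3 → 3 ≤ j → JoinedIn (S i j) (p i) (p j))
    (hd : ∀ a c b d, a < 3 → 3 ≤ c → b < 3 → 3 ≤ d → a ≠ b → c ≠ d →
      Disjoint (S a c) (S b d)) : False := by
  obtain ⟨n, hn⟩ := exists_turning_numbers p (fun i j => i < 3 ∧ 3 ≤ j) S
    (fun i j h => hS i j h.1 h.2)
    (fun a c b d h₁ h₂ hab _ _ hcd => hd a c b d h₁.1 h₁.2 h₂.1 h₂.2 hab hcd)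
  have e1 := hn 0 3 1 4 (by decide) (by decide) (by decide) (by decide) (by decide) (by decide)
  have e2 := hn 0 3 1 5 (by decide) (by decide) (by decide) (by decide) (by decide) (by decide)
  have e3 := hn 0 4 1 3 (by decide) (by decide) (by decide) (by decide) (by decide) (by decide)
  have e4 := hn 0 4 1 5 (by decide) (by decide) (by decide) (by decide) (by decide) (by decide)
  have e5 := hn 0 5 1 3 (by decide) (by decide) (by decide) (by decide) (by decide) (by decide)
  have e6 := hn 0 5 1 4 (by decide) (by decide) (by decide) (by decide) (by decide) (by decide)
  have e7 := hn 0 3 2 4 (by decide) (by decide) (by decide) (by decide) (by decide) (by decide)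
  have e8 := hn 0 3 2 5 (by decide) (by decide) (by decide) (by decide) (by decide) (by decide)
  have e9 := hn 0 4 2 3 (by decide) (by decide) (by decide) (by decide) (by decide) (by decide)
  have e10 := hn 0 4 2 5 (by decide) (by decide) (by decide) (by decide) (by decide) (by decide)
  have e11 := hn 0 5 2 3 (by decide) (by decide) (by decide) (by decide) (by decide) (by decide)
  have e12 := hn 0 5 2 4 (by decide) (by decide) (by decide) (by decide) (by decide) (by decide)
  have e13 := hn 1 3 2 4 (by decide) (by decide) (by decide) (by decide) (by decide) (by decide)
  have e14 := hn 1 3 2 5 (by decide) (by decide) (by decide) (by decide) (by decide) (by decide)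
  have e15 := hn 1 4 2 3 (by decide) (by decide) (by decide) (by decide) (by decide) (by decide)
  have e16 := hn 1 4 2 5 (by decide) (by decide) (by decide) (by decide) (by decide) (by decide)
  have e17 := hn 1 5 2 3 (by decide) (by decide) (by decide) (by decide) (by decide) (by decide)
  have e18 := hn 1 5 2 4 (by decide) (by decide) (by decide) (by decide) (by decide) (by decide)
  -- As for `K₅`, every turning number occurs twice. Nine of the eighteen pairs interleave, namely
  -- those with a < b and c < d, and nine is odd.
  simp [orderSign] at e1 e2 e3 e4 e5 e6 e7 e8 e9
  simp [orderSign] at e10 e11 e12 e13 e14 e15 e16 e17 e18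
  omega

/-! ### Minors of outerplanar graphs -/

namespace SimpleGraph

variable {V : Type*}

/-- One step along an edge inside a set of vertices. -/
def StepIn (G : SimpleGraph V) (X : Set V) (a b : V) : Prop := a ∈ X ∧ b ∈ X ∧ G.Adj a b

/-- Reachability inside a set of vertices. -/
def LinkedIn (G : SimpleGraph V) (X : Set V) : V → V → Prop := Relation.ReflTransGen (G.StepIn X)

/-- A (possibly empty) set of vertices that induces a connected subgraph. -/
def IsLinked (G : SimpleGraph V) (X : Set V) : Prop := ∀ u ∈ X, ∀ v ∈ X, G.LinkedIn X u v

/-- Two sets of vertices that are joined by an edge. -/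
def Touches (G : SimpleGraph V) (X Y : Set V) : Prop := ∃ u ∈ X, ∃ v ∈ Y, G.Adj u v

end SimpleGraph

/-! ### Connections in the plane obtained from a drawing -/

namespace PlaneDrawing

variable {V : Type*} {G : SimpleGraph V} (D : PlaneDrawing G)

/-- The part of the drawing that belongs to the subgraph induced by a set of vertices. -/
def body (X : Set V) : Set (ℝ × ℝ) :=
  {p | (∃ v ∈ X, p = D.point v) ∨ ∃ e : G.edgeSet, (∀ v ∈ (e : Sym2 V), v ∈ X) ∧ p ∈ D.arc e}

/-- The edges at a vertex, without their other ends. -/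
def star (v : V) : Set (ℝ × ℝ) :=
  {p | (p = D.point v ∨ ∃ e : G.edgeSet, v ∈ (e : Sym2 V) ∧ p ∈ D.arc e) ∧
    ∀ w, w ≠ v → p ≠ D.point w}

theorem body_mono {X Y : Set V} (h : X ⊆ Y) : D.body X ⊆ D.body Y := by
  rintro p (⟨v, hv, rfl⟩ | ⟨e, he, hp⟩)
  · exact Or.inl ⟨v, h hv, rfl⟩
  · exact Or.inr ⟨e, fun v hv => h (he v hv), hp⟩

theorem body_subset_support (X : Set V) : D.body X ⊆ D.support := by
  rintro p (⟨v, hv, rfl⟩ | ⟨e, he, hp⟩)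
  · exact Or.inl ⟨v, rfl⟩
  · exact Or.inr (Set.mem_iUnion.2 ⟨e, hp⟩)

theorem disjoint_body {X Y : Set V} (h : Disjoint X Y) : Disjoint (D.body X) (D.body Y) := by
  rw [Set.disjoint_left] at h ⊢
  rintro p (⟨v, hv, rfl⟩ | ⟨e, he, hp⟩) (⟨w, hw, hpw⟩ | ⟨f, hf, hpf⟩)
  · exact h hv (D.point_injective hpw ▸ hw)
  · exact h hv (hf _ (D.mem_of_point_mem_arc _ _ hpf))
  · subst hpw
    exact h (he _ (D.mem_of_point_mem_arc _ _ hp)) hw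
  · have hef : e ≠ f := by
      rintro rfl
      obtain ⟨v, hv⟩ : ∃ v, v ∈ (e : Sym2 V) := ⟨_, Sym2.out_fst_mem _⟩
      exact h (he v hv) (hf v hv)
    obtain ⟨v, hve, hvf, -⟩ := D.arc_inter_arc e f hef p ⟨hp, hpf⟩
    exact h (he v hve) (hf v hvf)

/-- An edge from v into Y meets the body of Y only at its end in Y, and `star` omits that end. -/
theorem disjoint_star_body {v : V} {Y : Set V} (h : v ∉ Y) : Disjoint (D.star v) (D.body Y) := by
  rw [Set.disjoint_left]
  rintro p ⟨rfl | ⟨e, he, hp⟩, hne⟩ (⟨w, hw, hpw⟩ | ⟨f, hf, hpf⟩)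
  · exact h (D.point_injective hpw ▸ hw)
  · exact h (hf _ (D.mem_of_point_mem_arc _ _ hpf))
  · exact hne w (fun hwv => h (hwv ▸ hw)) hpw
  · have hef : e ≠ f := by
      rintro rfl
      exact h (hf _ he)
    obtain ⟨w, -, hwf, hpw⟩ := D.arc_inter_arc e f hef p ⟨hp, hpf⟩
    exact hne w (fun hwv => h (hwv ▸ hf w hwf)) hpw

theorem joinedIn_arc {u v : V} (h : G.Adj u v) :
    JoinedIn (D.arc ⟨s(u, v), h⟩) (D.point u) (D.point v) := by
  obtain ⟨γ, -, hγ⟩ := D.arc_spec u v h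
  exact ⟨γ, fun t => hγ ▸ ⟨t, rfl⟩⟩

theorem joinedIn_body_of_adj {X : Set V} {u v : V} (h : G.Adj u v) (hu : u ∈ X) (hv : v ∈ X) :
    JoinedIn (D.body X) (D.point u) (D.point v) :=
  (D.joinedIn_arc h).mono fun p hp => Or.inr ⟨⟨s(u, v), h⟩, by simp [hu, hv], hp⟩

theorem joinedIn_body {X : Set V} {u v : V} (hu : u ∈ X) (h : G.LinkedIn X u v) :
    JoinedIn (D.body X) (D.point u) (D.point v) := by
  induction h with
  | refl => exact JoinedIn.refl (Or.inl ⟨u, hu, rfl⟩)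
  | tail _ h ih => exact ih.trans (D.joinedIn_body_of_adj h.2.2 h.1 h.2.1)

theorem isCompact_arc (e : G.edgeSet) : IsCompact (D.arc e) := by
  obtain ⟨e, he⟩ := e
  induction e using Sym2.ind with
  | _ u v =>
    obtain ⟨γ, -, hγ⟩ := D.arc_spec u v he
    rw [← hγ]
    exact isCompact_range γ.continuous

theorem isClosed_support [Finite V] : IsClosed D.support :=
  (Set.finite_range _).isClosed.union (isClosed_iUnion_of_finite fun e => (D.isCompact_arc e).isClosed)

/-- Follow the edge from q back to v. The arc is injective, so this portion misses the other end. -/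
theorem joinedIn_star {v : V} {q : ℝ × ℝ} (hq : q ∈ D.star v) :
    JoinedIn (D.star v) q (D.point v) := by
  rcases hq with ⟨rfl | ⟨e, he, hp⟩, hne⟩
  · exact JoinedIn.refl ⟨Or.inl rfl, hne⟩
  obtain ⟨e, hG⟩ := e
  obtain ⟨w, rfl⟩ := Sym2.mem_iff_exists.1 he
  obtain ⟨γ, hinj, hγ⟩ := D.arc_spec v w hG
  rw [← hγ] at hp
  obtain ⟨s, rfl⟩ := hp
  have hvw : w ≠ v := fun h => G.ne_of_adj hG h.symm
  have hs1 : s ≠ 1 := by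
    rintro rfl
    exact hne w hvw (by simp)
  symm
  refine JoinedIn.ofLine (f := fun t : ℝ => γ.extend (s * t)) (by fun_prop) (by simp) (by simp) ?_
  rintro _ ⟨t, ht, rfl⟩
  have hst : (s : ℝ) * t ∈ Set.Icc (0 : ℝ) 1 :=
    ⟨mul_nonneg s.2.1 ht.1, mul_le_one₀ s.2.2 ht.1 ht.2⟩
  have hval : γ.extend (s * t) = γ ⟨s * t, hst⟩ := γ.extend_apply hst
  have hmem : γ ⟨s * t, hst⟩ ∈ D.arc ⟨s(v, w), hG⟩ := hγ ▸ ⟨_, rfl⟩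
  simp only [hval]
  refine ⟨Or.inr ⟨_, he, hmem⟩, fun w' hw' h => ?_⟩
  have hmem' := D.mem_of_point_mem_arc w' _ (h ▸ hmem)
  have : w' = w := by simpa [hw'] using hmem'
  subst this
  have h1 : γ ⟨s * t, hst⟩ = γ 1 := by rw [h, γ.target]
  have h2 : (s : ℝ) * t = 1 := congrArg Subtype.val (hinj h1)
  have h3 : (s : ℝ) < 1 := lt_of_le_of_ne s.2.2 fun h => hs1 (Subtype.ext h)
  have h4 : (s : ℝ) * t ≤ s := mul_le_of_le_one_right s.2.1 ht.2
  linarith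

/-- Every vertex on the boundary of a face can be reached from the points of the face through the
face and the edges at that vertex. -/
theorem joinedIn_face_star [Finite V] {F : Set (ℝ × ℝ)} (hF : D.IsFace F) {v : V}
    (hv : D.point v ∈ frontier F) {o : ℝ × ℝ} (ho : o ∈ F) :
    JoinedIn (F ∪ D.star v) o (D.point v) := by
  have hopen : IsOpen D.supportᶜ := D.isClosed_support.isOpen_compl
  have hFs : F ⊆ D.supportᶜ := by
    obtain ⟨x, -, rfl⟩ := hF
    exact connectedComponentIn_subset _ _
  have hFpc : IsPathConnected F := by
    obtain ⟨x, hx, rfl⟩ := hF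
    exact (hopen.connectedComponentIn.isConnected_iff_isPathConnected).1
      (isConnected_connectedComponentIn_iff.2 hx)
  have hFmax : ∀ p ∈ F, connectedComponentIn D.supportᶜ p = F := by
    obtain ⟨x, hx, rfl⟩ := hF
    exact fun p hp => (connectedComponentIn_eq hp).symm
  -- K consists of the other vertices and of the edges not at v. It is closed and misses v, so near
  -- v the drawing contains only the star of v. A straight line from a nearby point of F to v stays
  -- in F until it first hits the drawing, and there it hits the star.
  let K : Set (ℝ × ℝ) := (⋃ w : {w // w ≠ v}, {D.point w}) ∪
    ⋃ e : {e : G.edgeSet // v ∉ (e : Sym2 V)}, D.arc e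
  have hK : IsClosed K := (isClosed_iUnion_of_finite fun _ => isClosed_singleton).union
    (isClosed_iUnion_of_finite fun e => (D.isCompact_arc e).isClosed)
  have hvK : D.point v ∈ Kᶜ := by
    rintro (h | h)
    · obtain ⟨w, hw⟩ := Set.mem_iUnion.1 h
      exact w.2 (D.point_injective hw).symm
    · obtain ⟨e, he⟩ := Set.mem_iUnion.1 h
      exact e.2 (D.mem_of_point_mem_arc _ _ he)
  obtain ⟨ε, hε, hball⟩ := Metric.isOpen_iff.1 hK.isOpen_compl _ hvK
  obtain ⟨p, hpF, hpd⟩ := Metric.mem_closure_iff.1 (frontier_subset_closure hv) ε hε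
  let l : ℝ → ℝ × ℝ := fun t => AffineMap.lineMap p (D.point v) t
  have hl : Continuous l := AffineMap.lineMap_continuous
  have hl0 : l 0 = p := AffineMap.lineMap_apply_zero _ _
  have hl1 : l 1 = D.point v := AffineMap.lineMap_apply_one _ _
  have hlball : ∀ t ∈ Set.Icc (0 : ℝ) 1, l t ∈ Metric.ball (D.point v) ε := fun t ht =>
    (convex_ball _ _).lineMap_mem (by rwa [Metric.mem_ball, dist_comm]) (Metric.mem_ball_self hε) ht
  have hT : IsCompact (Set.Icc (0 : ℝ) 1 ∩ l ⁻¹' D.support) :=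
    isCompact_Icc.inter_right (D.isClosed_support.preimage hl)
  obtain ⟨t₀, ⟨ht₀, hq⟩, hleast⟩ := hT.exists_isLeast
    ⟨1, ⟨zero_le_one, le_rfl⟩, by rw [Set.mem_preimage, hl1]; exact Or.inl ⟨v, rfl⟩⟩
  have hqK : l t₀ ∉ K := hball (hlball t₀ ht₀)
  have hstar : l t₀ ∈ D.star v := by
    have hne : ∀ w, w ≠ v → l t₀ ≠ D.point w := fun w hw h =>
      hqK (Or.inl (Set.mem_iUnion.2 ⟨⟨w, hw⟩, h⟩))
    refine ⟨?_, hne⟩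
    rcases hq with ⟨w, hw⟩ | h
    · by_cases hwv : w = v
      · exact Or.inl (hwv ▸ hw.symm)
      · exact (hne w hwv hw.symm).elim
    · obtain ⟨e, he⟩ := Set.mem_iUnion.1 h
      refine Or.inr ⟨e, by_contra fun hve => hqK (Or.inr (Set.mem_iUnion.2 ⟨⟨e, hve⟩, he⟩)), he⟩
  have hbefore : l '' Set.Ico 0 t₀ ⊆ F := by
    rcases eq_or_lt_of_le ht₀.1 with h0 | h0
    · rw [← h0]; simp
    rw [← hFmax p hpF]
    refine (isPreconnected_Ico.image l hl.continuousOn).subset_connectedComponentIn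
      ⟨0, ⟨le_rfl, h0⟩, hl0⟩ ?_
    rintro _ ⟨t, ht, rfl⟩ hmem
    exact absurd (hleast ⟨⟨ht.1, ht.2.le.trans ht₀.2⟩, hmem⟩) (not_le.2 ht.2)
  have h₁ : JoinedIn (F ∪ D.star v) o p :=
    (hFpc.joinedIn o ho p hpF).mono Set.subset_union_left
  have h₂ : JoinedIn (F ∪ D.star v) p (l t₀) := by
    refine JoinedIn.ofLine (f := fun t => l (t₀ * t)) (by fun_prop) (by simp [hl0]) (by simp) ?_
    rintro _ ⟨t, ht, rfl⟩
    have h1 : t₀ * t ≤ t₀ := mul_le_of_le_one_right ht₀.1 ht.2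
    rcases eq_or_lt_of_le h1 with h | h
    · simp only [h]
      exact Or.inr hstar
    · exact Or.inl (hbefore ⟨_, ⟨mul_nonneg ht₀.1 ht.1, h⟩, rfl⟩)
  exact (h₁.trans h₂).trans ((D.joinedIn_star hstar).mono Set.subset_union_right)

/-- A minor model in an outerplanar graph, together with a new vertex `z` in the outer face, gives
connections in the plane such that independent connections are disjoint. -/
theorem exists_connections [Finite V] {F : Set (ℝ × ℝ)} (hF : D.IsFace F)
    (hv : ∀ v, D.point v ∈ frontier F) {m : ℕ} (z : Fin m) (A : Fin m → Set V)
    (E : Fin m → Fin m → Prop) (hE : ∀ i j, E i j → j ≠ z)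
    (hdis : ∀ i j, i ≠ z → j ≠ z → i ≠ j → Disjoint (A i) (A j))
    (hlink : ∀ i, i ≠ z → G.IsLinked (A i)) (r : Fin m → V) (hr : ∀ i, i ≠ z → r i ∈ A i)
    (hadj : ∀ i j, E i j → i ≠ z → G.Touches (A i) (A j)) :
    ∃ (p : Fin m → ℂ) (S : Fin m → Fin m → Set ℂ), (∀ i j, E i j → JoinedIn (S i j) (p i) (p j)) ∧
      ∀ a c b d, E a c → E b d → a ≠ b → a ≠ d → c ≠ b → c ≠ d → Disjoint (S a c) (S b d) := by
  classical
  have hFs : Disjoint F D.support := by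
    obtain ⟨x, -, rfl⟩ := hF
    exact Set.disjoint_left.2 fun p hp => connectedComponentIn_subset _ _ hp
  obtain ⟨o, ho⟩ : F.Nonempty := by
    obtain ⟨x, hx, rfl⟩ := hF
    exact ⟨x, mem_connectedComponentIn hx⟩
  let p : Fin m → ℝ × ℝ := fun i => if i = z then o else D.point (r i)
  -- All connections at z may share the face F, since two edges at z are never independent.
  -- Likewise, connections using a common branch set may overlap.
  let S : Fin m → Fin m → Set (ℝ × ℝ) := fun i j =>
    if i = z then F ∪ D.star (r j) else D.body (A i ∪ A j)
  have hS : ∀ i j, E i j → JoinedIn (S i j) (p i) (p j) := by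
    intro i j hij
    have hj := hE i j hij
    by_cases hi : i = z
    · simpa [S, p, hi, hj] using D.joinedIn_face_star hF (hv (r j)) ho
    · obtain ⟨u, hu, w, hw, huw⟩ := hadj i j hij hi
      simp only [S, p, hi, hj, if_false]
      exact ((((D.joinedIn_body (hr i hi) (hlink i hi _ (hr i hi) _ hu))).mono
        (D.body_mono Set.subset_union_left)).trans
        (D.joinedIn_body_of_adj huw (Or.inl hu) (Or.inr hw))).trans
        ((D.joinedIn_body hw (hlink j hj _ hw _ (hr j hj))).mono
          (D.body_mono Set.subset_union_right))
  have key : ∀ c b d, b ≠ z → c ≠ z → d ≠ z → c ≠ b → c ≠ d →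
      Disjoint (F ∪ D.star (r c)) (D.body (A b ∪ A d)) := by
    intro c b d hb hc hd hcb hcd
    refine Set.disjoint_union_left.2 ⟨hFs.mono_right (D.body_subset_support _),
      D.disjoint_star_body ?_⟩
    rintro (h | h)
    · exact Set.disjoint_left.1 (hdis c b hc hb hcb) (hr c hc) h
    · exact Set.disjoint_left.1 (hdis c d hc hd hcd) (hr c hc) h
  have hd : ∀ a c b d, E a c → E b d → a ≠ b → a ≠ d → c ≠ b → c ≠ d →
      Disjoint (S a c) (S b d) := by
    intro a c b d hac hbd hab had hcb hcd
    have hc := hE a c hac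
    have hd := hE b d hbd
    by_cases ha : a = z
    · have hb : b ≠ z := fun h => hab (ha.trans h.symm)
      simpa [S, ha, hb] using key c b d hb hc hd hcb hcd
    · by_cases hb : b = z
      · simpa [S, ha, hb] using (key d a c ha hd hc had.symm hcd.symm).symm
      · simp only [S, ha, hb, if_false]
        refine D.disjoint_body (Set.disjoint_union_left.2 ⟨Set.disjoint_union_right.2 ⟨?_, ?_⟩,
          Set.disjoint_union_right.2 ⟨?_, ?_⟩⟩) <;> apply hdis <;> assumption
  let φ := Complex.equivRealProdCLM.symm
  refine ⟨fun i => φ (p i), fun i j => φ '' S i j, fun i j h => (hS i j h).map φ.continuous, ?_⟩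
  intro a c b d hac hbd h1 h2 h3 h4
  exact (Set.disjoint_image_iff φ.injective).2 (hd a c b d hac hbd h1 h2 h3 h4)

end PlaneDrawing

namespace SimpleGraph

variable {V : Type*} {G : SimpleGraph V}

/-- A graph without `K₄`-minor and without `K₂,₃`-minor. -/
structure OuterMinorFree (G : SimpleGraph V) : Prop where
  not_K4 : ∀ A B C D : Set V, G.IsLinked A → G.IsLinked B → G.IsLinked C → G.IsLinked D →
    Disjoint A B → Disjoint A C → Disjoint A D → Disjoint B C → Disjoint B D → Disjoint C D →
    G.Touches A B → G.Touches A C → G.Touches A D → G.Touches B C → G.Touches B D →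
    G.Touches C D → False
  not_K23 : ∀ P Q X Y Z : Set V, G.IsLinked P → G.IsLinked Q → G.IsLinked X → G.IsLinked Y →
    G.IsLinked Z → Disjoint P Q → Disjoint P X → Disjoint P Y → Disjoint P Z → Disjoint Q X →
    Disjoint Q Y → Disjoint Q Z → Disjoint X Y → Disjoint X Z → Disjoint Y Z →
    G.Touches P X → G.Touches P Y → G.Touches P Z → G.Touches Q X → G.Touches Q Y →
    G.Touches Q Z → False

theorem Touches.symm {X Y : Set V} (h : G.Touches X Y) : G.Touches Y X := by
  obtain ⟨u, hu, v, hv, huv⟩ := h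
  exact ⟨v, hv, u, hu, huv.symm⟩

theorem Touches.left_nonempty {X Y : Set V} (h : G.Touches X Y) : X.Nonempty := by
  obtain ⟨u, hu, -⟩ := h
  exact ⟨u, hu⟩

end SimpleGraph

/-- Outerplanar graphs have neither a `K₄`-minor nor a `K₂,₃`-minor. -/
theorem IsOuterplanar.outerMinorFree {V : Type*} [Finite V] {G : SimpleGraph V}
    (hG : IsOuterplanar G) : G.OuterMinorFree := by
  obtain ⟨D, F, ⟨hF, -⟩, hv⟩ := hG
  constructor
  · intro A B C E lA lB lC lE dAB dAC dAE dBC dBE dCE tAB tAC tAE tBC tBE tCE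
    obtain ⟨a, ha⟩ := tAB.left_nonempty
    obtain ⟨b, hb⟩ := tBC.left_nonempty
    obtain ⟨c, hc⟩ := tCE.left_nonempty
    obtain ⟨e, he⟩ := tCE.symm.left_nonempty
    -- `K₄` plus the new vertex is `K₅`. The entries ∅ and the first a are placeholders at the index
    -- of the new vertex.
    obtain ⟨p, S, hS, hd⟩ := D.exists_connections hF hv 0 ![∅, A, B, C, E] (· < ·)
      (fun i j h => (Fin.pos_of_ne_zero (Fin.ne_zero_of_lt h)).ne')
      (by simp [Fin.forall_fin_succ, *, Disjoint.symm])
      (by simp [Fin.forall_fin_succ, *]) ![a, a, b, c, e] (by simp [Fin.forall_fin_succ, *])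
      (by simp [Fin.forall_fin_succ, *])
    exact not_planar_K5 p S hS hd
  · intro P Q X Y Z lP lQ lX lY lZ dPQ dPX dPY dPZ dQX dQY dQZ dXY dXZ dYZ tPX tPY tPZ tQX tQY tQZ
    obtain ⟨a, ha⟩ := tPX.left_nonempty
    obtain ⟨b, hb⟩ := tQX.left_nonempty
    obtain ⟨x, hx⟩ := tPX.symm.left_nonempty
    obtain ⟨y, hy⟩ := tPY.symm.left_nonempty
    obtain ⟨z, hz⟩ := tPZ.symm.left_nonempty
    -- The new vertex joins the side of P and Q, which turns `K₂,₃` into `K₃,₃`.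
    obtain ⟨p, S, hS, hd⟩ := D.exists_connections hF hv 2 ![P, Q, ∅, X, Y, Z]
      (fun i j => i < 3 ∧ 3 ≤ j) (by rintro i _ h rfl; exact absurd h.2 (by decide))
      (by
        have := dPQ.symm; have := dPX.symm; have := dPY.symm; have := dPZ.symm
        have := dQX.symm; have := dQY.symm; have := dQZ.symm; have := dXY.symm
        have := dXZ.symm; have := dYZ.symm
        intro i j hi hj hij
        fin_cases i <;> fin_cases j <;> first | assumption | simp at hi hj hij)
      (by intro i hi; fin_cases i <;> first | assumption | simp at hi)
      ![a, b, a, x, y, z] (by intro i hi; fin_cases i <;> first | assumption | simp at hi)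
      (by
        rintro i j ⟨hi, hj⟩ hz
        fin_cases i <;> fin_cases j <;> first
          | assumption
          | exact absurd rfl hz
          | exact absurd hj (by decide)
          | exact absurd hi (by decide))
    exact not_planar_K33 p S (fun i j hi hj => hS i j ⟨hi, hj⟩)
      (fun a c b d ha hc hb hd' hab hcd => hd a c b d ⟨ha, hc⟩ ⟨hb, hd'⟩ hab
        (ha.trans_le hd').ne (hb.trans_le hc).ne' hcd)

/-! ### Crossing-free vertex orders -/

namespace SimpleGraph

variable {V : Type*} {G : SimpleGraph V}

theorem StepIn.symm {X : Set V} {u v : V} (h : G.StepIn X u v) : G.StepIn X v u :=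
  ⟨h.2.1, h.1, h.2.2.symm⟩

theorem LinkedIn.symm {X : Set V} {u v : V} (h : G.LinkedIn X u v) : G.LinkedIn X v u := by
  induction h with
  | refl => exact Relation.ReflTransGen.refl
  | tail _ h ih => exact Relation.ReflTransGen.head h.symm ih

theorem LinkedIn.mono {X Y : Set V} (hXY : X ⊆ Y) {u v : V} (h : G.LinkedIn X u v) :
    G.LinkedIn Y u v :=
  Relation.ReflTransGen.mono (fun _ _ h => ⟨hXY h.1, hXY h.2.1, h.2.2⟩) _ _ h

theorem LinkedIn.trans {X : Set V} {u v w : V} (h : G.LinkedIn X u v) (h' : G.LinkedIn X v w) :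
    G.LinkedIn X u w :=
  Relation.ReflTransGen.trans h h'

/-- The set of vertices that can be reached from `u` inside `X`. -/
def component (G : SimpleGraph V) (X : Set V) (u : V) : Set V := {v | G.LinkedIn X u v}

theorem mem_component_self {X : Set V} {u : V} : u ∈ G.component X u := Relation.ReflTransGen.refl

theorem component_subset {X : Set V} {u : V} (hu : u ∈ X) : G.component X u ⊆ X := by
  intro v hv
  rcases Relation.ReflTransGen.cases_tail hv with h | ⟨w, -, h⟩
  · exact h ▸ hu
  · exact h.2.1

theorem mem_component_of_adj {X : Set V} {u v w : V} (hu : u ∈ X) (hv : v ∈ G.component X u)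
    (hw : w ∈ X) (h : G.Adj v w) : w ∈ G.component X u :=
  Relation.ReflTransGen.tail hv ⟨component_subset hu hv, hw, h⟩

theorem linkedIn_component {X : Set V} {u v : V} (h : G.LinkedIn X u v) :
    G.LinkedIn (G.component X u) u v := by
  induction h with
  | refl => exact Relation.ReflTransGen.refl
  | tail h h' ih => exact ih.tail ⟨h, h.tail h', h'.2.2⟩

theorem isLinked_component {X : Set V} {u : V} : G.IsLinked (G.component X u) :=
  fun _ hv _ hw => (linkedIn_component hv).symm.trans (linkedIn_component hw)

theorem isLinked_singleton (u : V) : G.IsLinked {u} := by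
  rintro _ rfl _ rfl
  exact Relation.ReflTransGen.refl

theorem IsLinked.insert_vertex {W : Set V} (hW : G.IsLinked W) {w x : V} (hw : w ∈ W) (h : G.Adj w x) :
    G.IsLinked (insert x W) := by
  have key : ∀ u ∈ insert x W, G.LinkedIn (insert x W) w u := by
    rintro u (rfl | hu)
    · exact Relation.ReflTransGen.single ⟨Or.inr hw, Or.inl rfl, h⟩
    · exact (hW w hw u hu).mono (Set.subset_insert _ _)
  exact fun u hu v hv => (key u hu).symm.trans (key v hv)

/-- In a connected set, every component of the complement of a vertex contains a neighbour of that
vertex. -/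
theorem IsLinked.exists_adj_component {D : Set V} (hD : G.IsLinked D) {x y : V} (hx : x ∈ D)
    (hy : y ∈ D \ {x}) : ∃ k ∈ G.component (D \ {x}) y, G.Adj k x := by
  by_contra! hcon
  have : ∀ z, G.LinkedIn D y z → z ∈ G.component (D \ {x}) y := by
    intro z hz
    induction hz with
    | refl => exact mem_component_self
    | tail _ h ih =>
      refine mem_component_of_adj hy ih ⟨h.2.1, ?_⟩ h.2.2
      rintro rfl
      exact hcon _ ih h.2.2
  exact (component_subset hy (this x (hD y hy.1 x hx))).2 rfl

/-- An injective enumeration of `D` without crossing edges such that no edge passes over an element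
of `T`. -/
structure IsLayout (G : SimpleGraph V) (D T : Set V) (f : V → ℤ) : Prop where
  injOn : Set.InjOn f D
  noncrossing : ∀ a ∈ D, ∀ b ∈ D, ∀ c ∈ D, ∀ d ∈ D, f a < f b → f b < f c → f c < f d →
    G.Adj a c → G.Adj b d → False
  exposed : ∀ t ∈ T, ∀ a ∈ D, ∀ b ∈ D, f a < f t → f t < f b → G.Adj a b → False

theorem IsLayout.neg {D T : Set V} {f : V → ℤ} (h : G.IsLayout D T f) : G.IsLayout D T (-f) where
  injOn a ha b hb hab := h.injOn ha hb (by simpa using hab)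
  noncrossing a ha b hb c hc d hd hab hbc hcd hac hbd :=
    h.noncrossing d hd c hc b hb a ha (by simpa using hcd) (by simpa using hbc) (by simpa using hab)
      hbd.symm hac.symm
  exposed t ht a ha b hb hat htb hab :=
    h.exposed t ht b hb a ha (by simpa using htb) (by simpa using hat) hab.symm

theorem exists_concat [Finite V] (D₁ D₂ : Set V) (hD : Disjoint D₁ D₂) (f₁ f₂ : V → ℤ) :
    ∃ f : V → ℤ, (∀ a ∈ D₁, ∀ b ∈ D₁, f a < f b ↔ f₁ a < f₁ b) ∧
      (∀ a ∈ D₂, ∀ b ∈ D₂, f a < f b ↔ f₂ a < f₂ b) ∧ ∀ a ∈ D₁, ∀ b ∈ D₂, f a < f b := by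
  classical
  obtain ⟨M, hM⟩ := (Set.finite_range f₁).bddAbove
  obtain ⟨N, hN⟩ := (Set.finite_range f₂).bddBelow
  refine ⟨fun a => if a ∈ D₁ then f₁ a - M else f₂ a - N + 1, ?_, ?_, ?_⟩
  · intro a ha b hb
    simp [ha, hb]
  · intro a ha b hb
    simp [Set.disjoint_right.1 hD ha, Set.disjoint_right.1 hD hb]
  · intro a ha b hb
    simp only [ha, Set.disjoint_right.1 hD hb, if_true, if_false]
    have := hM ⟨a, rfl⟩
    have := hN ⟨b, rfl⟩
    omega

theorem injOn_of_concat {D₁ D₂ : Set V} {f f₁ f₂ : V → ℤ} (h₁ : Set.InjOn f₁ D₁)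
    (h₂ : Set.InjOn f₂ D₂) (e₁ : ∀ a ∈ D₁, ∀ b ∈ D₁, f a < f b ↔ f₁ a < f₁ b)
    (e₂ : ∀ a ∈ D₂, ∀ b ∈ D₂, f a < f b ↔ f₂ a < f₂ b) (e : ∀ a ∈ D₁, ∀ b ∈ D₂, f a < f b) :
    Set.InjOn f (D₁ ∪ D₂) := by
  rintro a (ha | ha) b (hb | hb) hab
  · exact h₁ ha hb (le_antisymm (not_lt.1 fun h => by have := (e₁ b hb a ha).2 h; omega)
      (not_lt.1 fun h => by have := (e₁ a ha b hb).2 h; omega))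
  · have := e a ha b hb; omega
  · have := e b hb a ha; omega
  · exact h₂ ha hb (le_antisymm (not_lt.1 fun h => by have := (e₂ b hb a ha).2 h; omega)
      (not_lt.1 fun h => by have := (e₂ a ha b hb).2 h; omega))

/-- The vertices of `D` with a neighbour in `W`. -/
def terminals (G : SimpleGraph V) (D W : Set V) : Set V := {t | t ∈ D ∧ ∃ w ∈ W, G.Adj w t}

/-- No edge passes over m, so a walk that avoids m cannot change sides. -/
theorem IsLayout.component_lt {K T : Set V} {f : V → ℤ} (hf : G.IsLayout K T f) {m p z : V}
    (hm : m ∈ T) (hmK : m ∈ K) (hpm : f p < f m)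
    (hz : z ∈ G.component (K \ {m}) p) : f z < f m := by
  induction hz with
  | refl => exact hpm
  | @tail b c _ h ih =>
    by_contra hc
    have hne : f c ≠ f m := fun he => h.2.1.2 (hf.injOn h.2.1.1 hmK he)
    exact hf.exposed m hm b h.1.1 c h.2.1.1 ih (by omega) h.2.2

theorem IsLayout.lt_component {K T : Set V} {f : V → ℤ} (hf : G.IsLayout K T f) {m p z : V}
    (hm : m ∈ T) (hmK : m ∈ K) (hpm : f m < f p)
    (hz : z ∈ G.component (K \ {m}) p) : f m < f z := by
  have := hf.neg.component_lt hm hmK (by simpa using hpm) hz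
  simpa using this

/-- This is a `K₂,₃`-minor: P and {m} are both joined to Q and to the components of p and q in K
without m. These components lie on different sides of m, hence are disjoint. -/
theorem OuterMinorFree.false_of_between (hG : G.OuterMinorFree) {K T P Q : Set V} {f : V → ℤ}
    (hf : G.IsLayout K T f) (hK : G.IsLinked K) (hP : G.IsLinked P) (hQ : G.IsLinked Q)
    (hPQ : Disjoint P Q) (hPK : Disjoint P K) (hQK : Disjoint Q K) (tPQ : G.Touches P Q)
    {p m q : V} (hm : m ∈ T) (hmK : m ∈ K) (hp : p ∈ K) (hq : q ∈ K) (hpm : f p < f m)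
    (hmq : f m < f q) (tp : G.Touches P {p}) (tq : G.Touches P {q}) (tm : G.Touches {m} Q) :
    False := by
  have hp' : p ∈ K \ {m} := ⟨hp, fun h => by rw [Set.mem_singleton_iff] at h; subst h; omega⟩
  have hq' : q ∈ K \ {m} := ⟨hq, fun h => by rw [Set.mem_singleton_iff] at h; subst h; omega⟩
  have hL := component_subset (G := G) hp'
  have hR := component_subset (G := G) hq'
  have hLK := hL.trans Set.sdiff_subset
  have hRK := hR.trans Set.sdiff_subset
  have hm1 : {m} ⊆ K := Set.singleton_subset_iff.2 hmK
  obtain ⟨k, hk, hkm⟩ := hK.exists_adj_component hmK hp'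
  obtain ⟨l, hl, hlm⟩ := hK.exists_adj_component hmK hq'
  refine hG.not_K23 P {m} Q (G.component (K \ {m}) p) (G.component (K \ {m}) q) hP
    (isLinked_singleton m) hQ isLinked_component isLinked_component (hPK.mono_right hm1) hPQ
    (hPK.mono_right hLK) (hPK.mono_right hRK) (hQK.mono_right hm1).symm
    (Set.disjoint_left.2 ?_) (Set.disjoint_left.2 ?_) (hQK.mono_right hLK) (hQK.mono_right hRK)
    (Set.disjoint_left.2 ?_) tPQ ?_ ?_ tm ⟨m, rfl, k, hk, hkm.symm⟩ ⟨m, rfl, l, hl, hlm.symm⟩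
  · exact fun z hz hz' => (hL hz').2 hz
  · exact fun z hz hz' => (hR hz').2 hz
  · intro z hz hz'
    have := hf.component_lt hm hmK hpm hz
    have := hf.lt_component hm hmK hmq hz'
    omega
  · obtain ⟨u, hu, _, rfl, h⟩ := tp
    exact ⟨u, hu, _, mem_component_self, h⟩
  · obtain ⟨u, hu, _, rfl, h⟩ := tq
    exact ⟨u, hu, _, mem_component_self, h⟩

/-- In a crossing-free order of a connected set, up to reversal the neighbours of `x` come before
the neighbours of `W`. -/
theorem OuterMinorFree.separated_terminals (hG : G.OuterMinorFree) {K W : Set V} {x : V}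
    {f : V → ℤ} (hf : G.IsLayout K (G.terminals K (insert x W)) f) (hK : G.IsLinked K)
    (hW : G.IsLinked W) (hxW : x ∉ W) (hWK : Disjoint W K) (hxK : x ∉ K) {w₀ : V} (hw₀ : w₀ ∈ W)
    (hw₀x : G.Adj w₀ x) :
    (∀ n ∈ K, ∀ t ∈ G.terminals K W, G.Adj x n → f n ≤ f t) ∨
      ∀ n ∈ K, ∀ t ∈ G.terminals K W, G.Adj x n → f t ≤ f n := by
  by_contra! hcon
  obtain ⟨⟨n, hn, t, ⟨ht, w, hw, hwt⟩, hxn, htn⟩, n', hn', t', ⟨ht', w', hw', hwt'⟩, hxn', hnt'⟩ :=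
    hcon
  have dx : Disjoint W {x} := Set.disjoint_singleton_right.2 hxW
  have dxK : Disjoint {x} K := Set.disjoint_singleton_left.2 hxK
  have tWx : G.Touches W {x} := ⟨w₀, hw₀, x, rfl, hw₀x⟩
  have eT : ∀ {u}, u ∈ K → ∀ {v}, v ∈ W → G.Adj v u → u ∈ G.terminals K (insert x W) :=
    fun hu _ hv h => ⟨hu, _, Or.inr hv, h⟩
  have eN : ∀ {u}, u ∈ K → G.Adj x u → u ∈ G.terminals K (insert x W) :=
    fun hu h => ⟨hu, _, Or.inl rfl, h⟩
  -- Neighbours of x and of W cannot alternate as W, x, W or as x, W, x. If both alternatives fail,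
  -- this forces t' = n and t = n', so x and W share two neighbours in K, which gives a `K₄`-minor.
  have pat₁ : ∀ {a b c}, a ∈ K → b ∈ K → c ∈ K → f a < f b → f b < f c → G.Touches W {a} →
      G.Adj x b → G.Touches W {c} → False := fun ha hb hc hab hbc h1 h2 h3 =>
    hG.false_of_between hf hK hW (isLinked_singleton x) dx hWK dxK tWx (eN hb h2) hb ha hc hab hbc
      h1 h3 ⟨_, rfl, x, rfl, h2.symm⟩
  have pat₂ : ∀ {a b c}, a ∈ K → b ∈ K → c ∈ K → f a < f b → f b < f c → G.Adj x a →
      (∃ w ∈ W, G.Adj w b) → G.Adj x c → False := by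
    rintro a b c ha hb hc hab hbc h1 ⟨w, hw, h2⟩ h3
    exact hG.false_of_between hf hK (isLinked_singleton x) hW dx.symm dxK hWK tWx.symm (eT hb hw h2)
      hb ha hc hab hbc ⟨x, rfl, _, rfl, h1⟩ ⟨x, rfl, _, rfl, h3⟩ ⟨_, rfl, w, hw, h2.symm⟩
  have h1 : ¬ f n < f t' := fun h =>
    pat₁ ht hn ht' htn h ⟨w, hw, _, rfl, hwt⟩ hxn ⟨w', hw', _, rfl, hwt'⟩
  have h2 : ¬ f t' < f n := fun h => pat₂ hn' ht' hn hnt' h hxn' ⟨w', hw', hwt'⟩ hxn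
  have h3 : ¬ f n' < f t := fun h => pat₂ hn' ht hn h htn hxn' ⟨w, hw, hwt⟩ hxn
  have h4 : ¬ f t < f n' := fun h =>
    pat₁ ht hn' ht' h hnt' ⟨w, hw, _, rfl, hwt⟩ hxn' ⟨w', hw', _, rfl, hwt'⟩
  obtain rfl : t' = n := hf.injOn ht' hn (by omega)
  obtain rfl : t = n' := hf.injOn ht hn' (by omega)
  have htK : t ∈ K \ {t'} := ⟨ht, fun h => by rw [Set.mem_singleton_iff] at h; subst h; omega⟩
  have hC := component_subset (G := G) htK
  obtain ⟨k, hk, hkn⟩ := hK.exists_adj_component hn htK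
  exact hG.not_K4 W {x} (G.component (K \ {t'}) t) {t'} hW (isLinked_singleton x)
    isLinked_component (isLinked_singleton t') dx (hWK.mono_right (hC.trans Set.sdiff_subset))
    (hWK.mono_right (Set.singleton_subset_iff.2 hn)) (dxK.mono_right (hC.trans Set.sdiff_subset))
    (dxK.mono_right (Set.singleton_subset_iff.2 hn))
    (Set.disjoint_left.2 fun z hz hz' => (hC hz).2 hz') tWx ⟨w, hw, t, mem_component_self, hwt⟩
    ⟨w', hw', _, rfl, hwt'⟩ ⟨x, rfl, t, mem_component_self, hxn'⟩ ⟨x, rfl, _, rfl, hxn⟩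
    ⟨k, hk, _, rfl, hkn⟩

/-- Among at least two vertices of a connected set there is one whose removal leaves all others in
one component. -/
theorem IsLinked.exists_nonseparating [Finite V] {D T : Set V} (hD : G.IsLinked D) (hT : T ⊆ D)
    (hnt : T.Nontrivial) :
    ∃ x ∈ T, ∃ y ∈ T, y ≠ x ∧ T \ {x} ⊆ G.component (D \ {x}) y := by
  obtain ⟨x₀, hx₀, y₀, hy₀, hne₀⟩ := hnt
  obtain ⟨⟨x, y⟩, ⟨hx, hy, hne⟩, hmax⟩ := Set.exists_max_image
    {q : V × V | q.1 ∈ T ∧ q.2 ∈ T ∧ q.2 ≠ q.1} (fun q => (G.component (D \ {q.1}) q.2).ncard)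
    (Set.toFinite _) ⟨(x₀, y₀), hx₀, hy₀, hne₀.symm⟩
  simp only at hx hy hne hmax
  refine ⟨x, hx, y, hy, hne, fun t ht => by_contra fun htK => ?_⟩
  have hyD : y ∈ D \ {x} := ⟨hT hy, hne⟩
  obtain ⟨k, hk, hkx⟩ := hD.exists_adj_component (hT hx) hyD
  -- With (x, y) chosen to maximize the component of y in D without x, a t outside it would give a
  -- larger one: removing t leaves that component intact and attached to x.
  have hle := hmax (t, x) ⟨ht.1, hx, fun h => ht.2 h.symm⟩
  simp only at hle
  have hxt : x ∈ D \ {t} := ⟨hT hx, fun h => ht.2 (Set.mem_singleton_iff.1 h).symm⟩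
  have hsub : insert x (G.component (D \ {x}) y) ⊆ G.component (D \ {t}) x := by
    have hKt : G.component (D \ {x}) y ⊆ D \ {t} := fun z hz =>
      ⟨(component_subset hyD hz).1, fun h => htK (Set.mem_singleton_iff.1 h ▸ hz)⟩
    refine Set.insert_subset mem_component_self fun z hz => ?_
    exact (Relation.ReflTransGen.single ⟨hxt, hKt hk, hkx.symm⟩).trans
      ((isLinked_component k hk z hz).mono hKt)
  have hxK : x ∉ G.component (D \ {x}) y := fun h => (component_subset hyD h).2 rfl
  have := Set.ncard_le_ncard hsub
  rw [Set.ncard_insert_of_notMem hxK] at this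
  omega

/-- One component and the rest of D are placed side by side. No edge runs between them. -/
theorem exists_layout_of_not_isLinked [Finite V] {D T : Set V} (hD : ¬ G.IsLinked D)
    (ih : ∀ D' ⊂ D, ∃ f, G.IsLayout D' (T ∩ D') f) (hT : T ⊆ D) : ∃ f, G.IsLayout D T f := by
  simp only [IsLinked, not_forall] at hD
  obtain ⟨u, hu, v, hv, huv⟩ := hD
  set L := G.component D u with hL
  have hLD : L ⊆ D := component_subset hu
  have hedge : ∀ a ∈ L, ∀ b ∈ D, G.Adj a b → b ∈ L := fun a ha b hb h =>
    mem_component_of_adj hu ha hb h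
  obtain ⟨f₁, h₁⟩ := ih L ⟨hLD, fun h => huv (h hv)⟩
  obtain ⟨f₂, h₂⟩ := ih (D \ L) ⟨Set.sdiff_subset, fun h => (h hu).2 mem_component_self⟩
  obtain ⟨f, e₁, e₂, e⟩ := exists_concat L (D \ L) Set.disjoint_sdiff_right f₁ f₂
  have hinj := injOn_of_concat h₁.injOn h₂.injOn e₁ e₂ e
  rw [Set.union_sdiff_cancel hLD] at hinj
  have low : ∀ a ∈ D, ∀ b ∈ L, f a < f b → a ∈ L := fun a ha b hb hab => by_contra fun h => by
    have := e b hb a ⟨ha, h⟩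
    omega
  have hedge' : ∀ a ∈ D, ∀ b ∈ D, G.Adj a b → (a ∈ L ↔ b ∈ L) := fun a ha b hb h =>
    ⟨fun h' => hedge a h' b hb h, fun h' => hedge b h' a ha h.symm⟩
  refine ⟨f, hinj, ?_, ?_⟩
  · intro a ha b hb c hc d hd hab hbc hcd hac hbd
    have i₁ := hedge' a ha c hc hac
    have i₂ := hedge' b hb d hd hbd
    by_cases haL : a ∈ L
    · have hcL := i₁.1 haL
      have hbL := low b hb c hcL hbc
      have hdL := i₂.1 hbL
      exact h₁.noncrossing a haL b hbL c hcL d hdL ((e₁ a haL b hbL).1 hab) ((e₁ b hbL c hcL).1 hbc)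
        ((e₁ c hcL d hdL).1 hcd) hac hbd
    · have hbL : b ∉ L := fun h => haL (low a ha b h hab)
      have hcL := mt i₁.2 haL
      have hdL := mt i₂.2 hbL
      exact h₂.noncrossing a ⟨ha, haL⟩ b ⟨hb, hbL⟩ c ⟨hc, hcL⟩ d ⟨hd, hdL⟩
        ((e₂ a ⟨ha, haL⟩ b ⟨hb, hbL⟩).1 hab) ((e₂ b ⟨hb, hbL⟩ c ⟨hc, hcL⟩).1 hbc)
        ((e₂ c ⟨hc, hcL⟩ d ⟨hd, hdL⟩).1 hcd) hac hbd
  · intro t ht a ha b hb hat htb hab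
    have htD := hT ht
    have i := hedge' a ha b hb hab
    by_cases haL : a ∈ L
    · have hbL := i.1 haL
      have htL := low t htD b hbL htb
      exact h₁.exposed t ⟨ht, htL⟩ a haL b hbL ((e₁ a haL t htL).1 hat) ((e₁ t htL b hbL).1 htb) hab
    · have htL : t ∉ L := fun h => haL (low a ha t h hat)
      have hbL := mt i.2 haL
      exact h₂.exposed t ⟨ht, htD, htL⟩ a ⟨ha, haL⟩ b ⟨hb, hbL⟩
        ((e₂ a ⟨ha, haL⟩ t ⟨htD, htL⟩).1 hat) ((e₂ t ⟨htD, htL⟩ b ⟨hb, hbL⟩).1 htb) hab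

/-- Put s first. It is then exposed, and its edges cross nothing because its neighbours are exposed
in the order of the rest. -/
theorem exists_layout_of_subset_singleton [Finite V] {D T : Set V} {s : V} (hs : s ∈ D)
    (hT : T ⊆ {s}) (ih : ∃ f, G.IsLayout (D \ {s}) (G.terminals (D \ {s}) {s}) f) :
    ∃ f, G.IsLayout D T f := by
  obtain ⟨f₂, h₂⟩ := ih
  obtain ⟨f, e₁, e₂, e⟩ := exists_concat {s} (D \ {s}) Set.disjoint_sdiff_right f₂ f₂
  have hinj := injOn_of_concat (Set.injOn_singleton f₂ s) h₂.injOn e₁ e₂ e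
  rw [Set.union_sdiff_cancel (Set.singleton_subset_iff.2 hs)] at hinj
  have low : ∀ a ∈ D, ¬ f a < f s := fun a ha h => by
    by_cases has : a = s
    · subst has; omega
    · have := e s rfl a ⟨ha, has⟩
      omega
  have hpos : ∀ a ∈ D, ∀ b ∈ D, f a < f b → b ∈ D \ {s} := fun a ha b hb h =>
    ⟨hb, fun hbs => low a ha (Set.mem_singleton_iff.1 hbs ▸ h)⟩
  refine ⟨f, hinj, ?_, ?_⟩
  · intro a ha b hb c hc d hd hab hbc hcd hac hbd
    have hb' := hpos a ha b hb hab
    have hc' := hpos b hb c hc hbc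
    have hd' := hpos c hc d hd hcd
    have hbc' := (e₂ b hb' c hc').1 hbc
    have hcd' := (e₂ c hc' d hd').1 hcd
    by_cases has : a = s
    · exact h₂.exposed c ⟨hc', s, rfl, has ▸ hac⟩ b hb' d hd' hbc' hcd' hbd
    · exact h₂.noncrossing a ⟨ha, has⟩ b hb' c hc' d hd' ((e₂ a ⟨ha, has⟩ b hb').1 hab) hbc' hcd'
        hac hbd
  · intro t ht a ha b hb hat _ _
    exact low a ha (Set.mem_singleton_iff.1 (hT ht) ▸ hat)

/-- Two layouts are put on the two sides of a vertex `x`. -/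
theorem exists_layout_of_sides [Finite V] {K K' T : Set V} {x : V} {f f' : V → ℤ}
    (hf : G.IsLayout K (T ∩ K) f) (hfx : ∀ n ∈ K, G.Adj x n → ∀ a ∈ K, ∀ b ∈ K, f a < f n →
      f n < f b → G.Adj a b → False)
    (hf' : G.IsLayout K' (G.terminals K' {x}) f') (hxK : x ∉ K) (hxK' : x ∉ K')
    (hKK' : Disjoint K' K) (hedge : ∀ a ∈ K', ∀ b ∈ K, ¬ G.Adj a b) (hT : T ⊆ insert x K)
    (hord : ∀ n ∈ K, ∀ t ∈ T ∩ K, G.Adj x n → f n ≤ f t) :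
    ∃ g, G.IsLayout (K' ∪ insert x K) T g := by
  -- The final order is K', x, K. Edges at x cross nothing, because the neighbours of x are exposed
  -- on either side. By `hord`, edges from x into K pass over no element of T.
  obtain ⟨g, e₁, e₂, e⟩ := exists_concat {x} K (Set.disjoint_singleton_left.2 hxK) f f
  have hinj := injOn_of_concat (Set.injOn_singleton f x) hf.injOn e₁ e₂ e
  have hdis : Disjoint K' ({x} ∪ K) :=
    Set.disjoint_union_right.2 ⟨Set.disjoint_singleton_right.2 hxK', hKK'⟩
  obtain ⟨h, i₁, i₂, i⟩ := exists_concat K' ({x} ∪ K) hdis f' g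
  have hinj' := injOn_of_concat hf'.injOn hinj i₁ i₂ i
  have xK : ∀ b ∈ K, h x < h b := fun b hb => (i₂ x (Or.inl rfl) b (Or.inr hb)).2 (e x rfl b hb)
  have Kx : ∀ a ∈ K', h a < h x := fun a ha => i a ha x (Or.inl rfl)
  have KK : ∀ a ∈ K', ∀ b ∈ K, h a < h b := fun a ha b hb => i a ha b (Or.inr hb)
  have eK : ∀ a ∈ K, ∀ b ∈ K, h a < h b ↔ f a < f b := fun a ha b hb =>
    (i₂ a (Or.inr ha) b (Or.inr hb)).trans (e₂ a ha b hb)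
  have above : ∀ a ∈ insert x K, ∀ b ∈ K' ∪ insert x K, h a < h b → b ∈ K := by
    rintro a (rfl | ha) b (hb | rfl | hb) hab
    · have := Kx b hb; omega
    · omega
    · exact hb
    · have := KK b hb a ha; omega
    · have := xK a ha; omega
    · exact hb
  have below : ∀ a ∈ K', ∀ b ∈ K' ∪ insert x K, h b < h a → b ∈ K' := by
    rintro a ha b (hb | rfl | hb) hab
    · exact hb
    · have := Kx a ha; omega
    · have := KK a ha b hb; omega
  refine ⟨h, hinj', ?_, ?_⟩
  · intro a ha b hb c hc d hd hab hbc hcd hac hbd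
    rcases ha with ha | ha
    · rcases hc with hc | rfl | hc
      · have hb' := below c hc b hb hbc
        rcases hd with hd | rfl | hd
        · exact hf'.noncrossing a ha b hb' c hc d hd ((i₁ a ha b hb').1 hab)
            ((i₁ b hb' c hc).1 hbc) ((i₁ c hc d hd).1 hcd) hac hbd
        · exact hf'.exposed b ⟨hb', _, rfl, hbd.symm⟩ a ha c hc ((i₁ a ha b hb').1 hab)
            ((i₁ b hb' c hc).1 hbc) hac
        · exact hedge b hb' d hd hbd
      · have hdK := above c (Or.inl rfl) d hd hcd
        rcases hb with hb | rfl | hb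
        · exact hedge b hb d hdK hbd
        · omega
        · have := xK b hb; omega
      · exact hedge a ha c hc hac
    · have hbK := above a ha b hb hab
      have hcK := above b (Or.inr hbK) c hc hbc
      have hdK := above c (Or.inr hcK) d hd hcd
      have hbc' := (eK b hbK c hcK).1 hbc
      have hcd' := (eK c hcK d hdK).1 hcd
      rcases ha with rfl | ha
      · exact hfx c hcK hac b hbK d hdK hbc' hcd' hbd
      · exact hf.noncrossing a ha b hbK c hcK d hdK ((eK a ha b hbK).1 hab) hbc' hcd' hac hbd
  · intro t ht a ha b hb hat htb hab
    have hbK := above t (hT ht) b hb htb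
    rcases ha with ha | rfl | ha
    · exact hedge a ha b hbK hab
    · rcases hT ht with rfl | htK
      · omega
      · have := hord b hbK t ⟨ht, htK⟩ hab
        have := (eK t htK b hbK).1 htb
        omega
    · rcases hT ht with rfl | htK
      · have := xK a ha; omega
      · exact hf.exposed t ⟨ht, htK⟩ a ha b hbK ((eK a ha t htK).1 hat) ((eK t htK b hbK).1 htb) hab

theorem IsLayout.mono_right {D T T' : Set V} {f : V → ℤ} (h : G.IsLayout D T f) (hT : T' ⊆ T) :
    G.IsLayout D T' f :=
  ⟨h.injOn, h.noncrossing, fun t ht => h.exposed t (hT ht)⟩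

/-- In a graph without `K₄`- and `K₂,₃`-minors, every set of vertices has a crossing-free order in
which all neighbours of a given connected set outside it are exposed. -/
theorem OuterMinorFree.exists_layout [Finite V] (hG : G.OuterMinorFree) (D : Set V) :
    ∀ W : Set V, G.IsLinked W → Disjoint W D → ∃ f, G.IsLayout D (G.terminals D W) f := by
  induction D using WellFoundedLT.induction with
  | _ D ih =>
  intro W hW hWD
  by_cases hD : G.IsLinked D
  swap
  · refine exists_layout_of_not_isLinked hD (fun D' hD' => ?_) fun t ht => ht.1
    obtain ⟨f, hf⟩ := ih D' hD' W hW (hWD.mono_right hD'.1)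
    exact ⟨f, hf.mono_right fun t ht => ⟨ht.2, ht.1.2⟩⟩
  rcases Set.eq_empty_or_nonempty D with rfl | ⟨s₀, hs₀⟩
  · exact ⟨fun _ => 0, by simp, by simp, by simp⟩
  by_cases hnt : (G.terminals D W).Nontrivial
  swap
  · obtain ⟨s, hs, hTs⟩ : ∃ s ∈ D, G.terminals D W ⊆ {s} := by
      rcases (Set.not_nontrivial_iff.1 hnt).eq_empty_or_singleton with h | ⟨s, h⟩
      · exact ⟨s₀, hs₀, by simp [h]⟩
      · exact ⟨s, (h.symm ▸ rfl : s ∈ G.terminals D W).1, h.subset⟩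
    refine exists_layout_of_subset_singleton hs hTs (ih (D \ {s}) ⟨Set.sdiff_subset, fun h => (h hs).2 rfl⟩
      {s} (isLinked_singleton s) Set.disjoint_sdiff_right)
  -- All terminals other than x lie in one component K of D without x. Thus K is ordered with
  -- respect to W together with x, while the remaining vertices need only respect x.
  obtain ⟨x, ⟨hxD, w, hw, hwx⟩, y, hy, hyx, hsub⟩ :=
    hD.exists_nonseparating (fun t ht => ht.1) hnt
  have hyD : y ∈ D \ {x} := ⟨hy.1, hyx⟩
  set K := G.component (D \ {x}) y with hKdef
  have hKD : K ⊆ D \ {x} := component_subset hyD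
  have hxK : x ∉ K := fun h => (hKD h).2 rfl
  have hxW : x ∉ W := fun h => Set.disjoint_left.1 hWD h hxD
  have hWK : Disjoint W K := hWD.mono_right (hKD.trans Set.sdiff_subset)
  obtain ⟨f, hf⟩ := ih K ⟨hKD.trans Set.sdiff_subset, fun h => hxK (h hxD)⟩ (insert x W)
    (hW.insert_vertex hw hwx) (Set.disjoint_insert_left.2 ⟨hxK, hWK⟩)
  obtain ⟨f', hf'⟩ := ih (D \ insert x K)
    ⟨Set.sdiff_subset, fun h => (h hxD).2 (Set.mem_insert x K)⟩
    {x} (isLinked_singleton x)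
    (Set.disjoint_singleton_left.2 fun h => h.2 (Set.mem_insert x K))
  have hunion : D \ insert x K ∪ insert x K = D :=
    Set.sdiff_union_of_subset (Set.insert_subset hxD (hKD.trans Set.sdiff_subset))
  have main : ∀ f, G.IsLayout K (G.terminals K (insert x W)) f →
      (∀ n ∈ K, ∀ t ∈ G.terminals K W, G.Adj x n → f n ≤ f t) →
      ∃ g, G.IsLayout D (G.terminals D W) g := by
    intro f hf hord
    have := exists_layout_of_sides (T := G.terminals D W) (f := f) (x := x)
      (hf.mono_right fun t ht => ⟨ht.2, ht.1.2.imp fun w hw => ⟨Or.inr hw.1, hw.2⟩⟩)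
      (fun n hn hxn => hf.exposed n ⟨hn, x, Or.inl rfl, hxn⟩) hf' hxK (fun h => h.2 (Or.inl rfl))
      (Set.disjoint_left.2 fun z hz hz' => hz.2 (Or.inr hz'))
      (fun a ha b hb hab => ha.2 (Or.inr (mem_component_of_adj hyD hb
        ⟨ha.1, fun h => ha.2 (Or.inl h)⟩ hab.symm)))
      (fun t ht => by
        by_cases htx : t = x
        · exact Or.inl htx
        · exact Or.inr (hsub ⟨ht, htx⟩))
      (fun n hn t ht => hord n hn t ⟨ht.2, ht.1.2⟩)
    rwa [hunion] at this
  rcases hG.separated_terminals hf isLinked_component hW hxW hWK hxK hw hwx with h | h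
  · exact main f hf h
  · exact main (-f) hf.neg fun n hn t ht hxn => by simpa using h n hn t ht hxn

end SimpleGraph

/-! ### Unit grid intersection representations from crossing-free orders -/

/-- The positions of a vertex and of its ancestors, read as the digits of a number in base `B`. -/
def ancestorCode {V : Type*} (pos : V → ℕ) (par : V → V) (B : ℕ) : ℕ → V → ℕ
  | 0, v => pos v
  | k + 1, v => ancestorCode pos par B k (par v) * B + pos v

/-- If the vertices of every level of a forest are ordered and taking parents is monotone, then there
is a common order of all levels in which a vertex comes immediately before its parent. -/
theorem exists_postorder {V : Type*} (pos lev : V → ℕ) (par : V → V) (B : ℕ)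
    (hinj : Function.Injective pos) (hB : ∀ v, pos v + 1 < B)
    (hpar : ∀ v, lev v ≠ 0 → lev (par v) + 1 = lev v)
    (hmono : ∀ v w, lev v = lev w → lev v ≠ 0 → pos v < pos w → pos (par v) ≤ pos (par w)) :
    ∃ ξ : V → ℝ, (∀ v, 0 < ξ v ∧ ξ v < 1 / 4) ∧
      (∀ v w, lev v = lev w → pos v < pos w → ξ v < ξ w) ∧
      (∀ v, lev v ≠ 0 → ξ v < ξ (par v)) ∧
      ∀ v w, lev v ≠ 0 → lev w = lev (par v) → pos w < pos (par v) → ξ w < ξ v := by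
  set C := ancestorCode pos par B with hC
  have succ_eq : ∀ k v, C (k + 1) v = C k (par v) * B + pos v := fun _ _ => rfl
  have hlt : ∀ k v w, lev v = k → lev w = k → pos v < pos w → C k v < C k w := by
    intro k
    induction k with
    | zero => exact fun v w _ _ h => h
    | succ k ih =>
      intro v w hv hw h
      have hv' := hpar v (by omega)
      have hw' := hpar w (by omega)
      rw [succ_eq, succ_eq]
      rcases (hmono v w (hv.trans hw.symm) (by omega) h).eq_or_lt with he | hl
      · rw [hinj he]; omega
      · have := ih _ _ (by omega) (by omega) hl
        have := hB v
        nlinarith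
  have hbound : ∀ k v, C k v + 1 ≤ B ^ (k + 1) := by
    intro k
    induction k with
    | zero => intro v; have := hB v; simp [hC, ancestorCode]; omega
    | succ k ih =>
      intro v
      have h1 := ih (par v)
      have h2 := hB v
      rw [succ_eq, pow_succ]
      nlinarith
  by_cases hV : Nonempty V
  swap
  · exact ⟨fun _ => 0, fun v => (hV ⟨v⟩).elim, fun v => (hV ⟨v⟩).elim, fun v => (hV ⟨v⟩).elim,
      fun v => (hV ⟨v⟩).elim⟩
  have hB0 : 0 < (B : ℝ) := by
    obtain ⟨v⟩ := hV
    have := hB v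
    exact_mod_cast (by omega : 0 < B)
  have hs : (0 : ℝ) < 4 * (B + 1) := by positivity
  -- Up to scale, v receives the right end of the interval from C / B^lev to (C + 1) / B^lev. A
  -- child has a subinterval of its parent's whose right end is strictly smaller, as `pos v + 1 <
  -- B`. The final divisor brings all values below 1/4.
  refine ⟨fun v => (C (lev v) v + 1) / B ^ lev v / (4 * (B + 1)), fun v => ⟨by positivity, ?_⟩,
    fun v w hvw h => ?_, fun v hv => ?_, fun v w hv hw h => ?_⟩
  · rw [div_lt_iff₀ hs, div_lt_iff₀ (by positivity)]
    have h1 : ((C (lev v) v + 1 : ℕ) : ℝ) ≤ (B ^ (lev v + 1) : ℕ) := by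
      exact_mod_cast hbound _ _
    push_cast at h1
    rw [pow_succ] at h1
    have : (0 : ℝ) < B ^ lev v := by positivity
    nlinarith
  · have : (C (lev v) v : ℝ) < C (lev v) w := by exact_mod_cast hlt _ v w rfl hvw.symm h
    simp only
    rw [← hvw]
    gcongr
  · have hp := hpar v hv
    have h1 : (pos v : ℝ) + 1 < B := by exact_mod_cast hB v
    simp only
    rw [← hp, succ_eq, div_lt_div_iff_of_pos_right hs, div_lt_div_iff₀ (by positivity) (by positivity),
      pow_succ]
    push_cast
    have : (0 : ℝ) < B ^ lev (par v) := by positivity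
    nlinarith
  · have hp := hpar v hv
    have h1 : (C (lev (par v)) w : ℝ) + 1 ≤ C (lev (par v)) (par v) := by
      exact_mod_cast hlt _ w (par v) hw rfl h
    simp only
    rw [← hp, succ_eq, div_lt_div_iff_of_pos_right hs, div_lt_div_iff₀ (by positivity) (by positivity),
      pow_succ, hw]
    push_cast
    have h2 : (0 : ℝ) < B ^ lev (par v) := by positivity
    have h3 : (0 : ℝ) ≤ pos v := by positivity
    have h4 : ((C (lev (par v)) w : ℝ) + 1) * B < C (lev (par v)) (par v) * B + pos v + 1 := by
      nlinarith
    nlinarith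

theorem exists_between_avoiding (lo hi bad : Set ℝ) (hlo : lo.Finite) (hhi : hi.Finite)
    (hbad : bad.Finite) (h : ∀ x ∈ lo, ∀ y ∈ hi, x < y) :
    ∃ m, (∀ x ∈ lo, x < m) ∧ (∀ y ∈ hi, m < y) ∧ m ∉ bad := by
  obtain ⟨p, hp₁, hp₂⟩ := Order.exists_between_finsets hlo.toFinset hhi.toFinset (by simpa using h)
  obtain ⟨q, hq₁, hq₂⟩ := Order.exists_between_finsets {p} hhi.toFinset (by simpa using hp₂)
  have hpq : p < q := hq₁ p (by simp)
  obtain ⟨m, hm, hmb⟩ := (Set.Ioo_infinite hpq).exists_notMem_finite hbad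
  exact ⟨m, fun x hx => (hp₁ x (by simpa using hx)).trans hm.1,
    fun y hy => hm.2.trans (hq₂ y (by simpa using hy)), hmb⟩

/-- Coordinates of unit segments (vertical ones for the vertices, horizontal ones for the edges) that
represent the vertex-edge incidence poset of a graph. -/
def HasUnitGridCoordinates {V : Type*} (G : SimpleGraph V) : Prop :=
  ∃ (x y : V → ℝ) (a b : G.edgeSet → ℝ), Function.Injective x ∧ Function.Injective b ∧
    ∀ (v : V) (e : G.edgeSet), v ∈ (e : Sym2 V) ↔
      (a e ≤ x v ∧ x v ≤ a e + 1) ∧ y v ≤ b e ∧ b e ≤ y v + 1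

/-- Segments of missing edges and vertices can be dropped, so edges may be added freely before
coordinates are constructed. -/
theorem HasUnitGridCoordinates.of_embedding {V W : Type*} {G : SimpleGraph V} {H : SimpleGraph W}
    (hH : HasUnitGridCoordinates H) (φ : V → W) (hφ : Function.Injective φ)
    (hadj : ∀ u v, G.Adj u v → H.Adj (φ u) (φ v)) : HasUnitGridCoordinates G := by
  obtain ⟨x, y, a, b, hx, hb, h⟩ := hH
  have hmap : ∀ e ∈ G.edgeSet, e.map φ ∈ H.edgeSet := by
    intro e he
    induction e using Sym2.ind with
    | _ u v => exact hadj u v he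
  let ψ : G.edgeSet → H.edgeSet := fun e => ⟨(e : Sym2 V).map φ, hmap e e.2⟩
  have hψ : Function.Injective ψ := fun e f hef =>
    Subtype.ext (Sym2.map.injective hφ (congrArg Subtype.val hef))
  refine ⟨x ∘ φ, y ∘ φ, a ∘ ψ, b ∘ ψ, hx.comp hφ, hb.comp hψ, fun v e => ?_⟩
  rw [Function.comp_apply, Function.comp_apply, Function.comp_apply, Function.comp_apply, ← h]
  constructor
  · exact fun hv => Sym2.mem_map.2 ⟨v, hv, rfl⟩
  · intro hv
    obtain ⟨w, hw, hwv⟩ := Sym2.mem_map.1 hv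
    exact hφ hwv ▸ hw

theorem HasUnitGridCoordinates.isUGIG {V : Type*} {G : SimpleGraph V}
    (h : HasUnitGridCoordinates G) : IsUGIG (comparabilityGraph (IncidencePoset G)) := by
  obtain ⟨x, y, a, b, hx, hb, h⟩ := h
  let seg : IncidencePoset G → GridSegment := fun z => match z with
    | .vertex v => ⟨false, x v, y v, 1, one_pos⟩
    | .edge e => ⟨true, a e, b e, 1, one_pos⟩
  have hve : ∀ v e, ((seg (.vertex v)).toSet ∩ (seg (.edge e)).toSet).Nonempty ↔
      v ∈ (e : Sym2 V) := by
    intro v e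
    rw [h]
    constructor
    · rintro ⟨⟨p, q⟩, h1, h2⟩
      simp only [seg, GridSegment.toSet, Bool.false_eq_true, if_false, if_true, Set.mem_prod,
        Set.mem_singleton_iff, Set.mem_Icc] at h1 h2
      obtain ⟨rfl, h1⟩ := h1
      obtain ⟨h2, rfl⟩ := h2
      exact ⟨h2, h1⟩
    · rintro ⟨h1, h2⟩
      refine ⟨(x v, b e), ?_, ?_⟩
      · simpa [seg, GridSegment.toSet] using h2
      · simpa [seg, GridSegment.toSet] using h1
  have hpar : ∀ u v, u ≠ v → (seg u).horizontal = (seg v).horizontal →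
      Disjoint (seg u).toSet (seg v).toSet := by
    rintro (u | e) (v | f) hne hh
    · refine Set.disjoint_left.2 fun p h1 h2 => hne ?_
      simp only [seg, GridSegment.toSet, Bool.false_eq_true, if_false, Set.mem_prod,
        Set.mem_singleton_iff] at h1 h2
      rw [hx (h1.1.symm.trans h2.1)]
    · simp [seg] at hh
    · simp [seg] at hh
    · refine Set.disjoint_left.2 fun p h1 h2 => hne ?_
      simp only [seg, GridSegment.toSet, if_true, Set.mem_prod, Set.mem_singleton_iff] at h1 h2
      rw [hb (h1.2.symm.trans h2.2)]
  have le_vv : ∀ u v : V, IncidencePoset.vertex (G := G) u ≤ .vertex v ↔ u = v :=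
    fun _ _ => Iff.rfl
  have le_ve : ∀ (u : V) (e : G.edgeSet), IncidencePoset.vertex (G := G) u ≤ .edge e ↔
      u ∈ (e : Sym2 V) := fun _ _ => Iff.rfl
  have le_ev : ∀ (u : V) (e : G.edgeSet), IncidencePoset.edge e ≤ .vertex u ↔ False :=
    fun _ _ => Iff.rfl
  have le_ee : ∀ e f : G.edgeSet, IncidencePoset.edge e ≤ .edge f ↔ e = f := fun _ _ => Iff.rfl
  refine ⟨⟨seg, ?_, hpar⟩, ?_⟩
  · rintro (u | e) (v | f) hne
    · rw [← Set.not_disjoint_iff_nonempty_inter]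
      have hd := hpar _ _ hne rfl
      have huv : u ≠ v := fun h => hne (h ▸ rfl)
      simp [comparabilityGraph, le_vv, huv, huv.symm, hd]
    · rw [hve]
      simp [comparabilityGraph, le_ve, le_ev]
    · rw [Set.inter_comm, hve]
      simp [comparabilityGraph, le_ve, le_ev]
    · rw [← Set.not_disjoint_iff_nonempty_inter]
      have hd := hpar _ _ hne rfl
      have hef : e ≠ f := fun h => hne (h ▸ rfl)
      simp [comparabilityGraph, le_ee, hef, hef.symm, hd]
  · rintro (u | e) (v | f) <;> rfl

/-! ### Levels in a crossing-free order and the resulting coordinates -/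

namespace SimpleGraph

/-- A crossing-free order of the vertices of a graph together with a level function that behaves like
the distance from the first vertex. -/
structure IsLeveled {N : ℕ} (G : SimpleGraph (Fin N)) (lev : Fin N → ℕ) : Prop where
  noncrossing : ∀ a b c d, a < b → b < c → c < d → G.Adj a c → G.Adj b d → False
  lev_adj : ∀ u v, G.Adj u v → lev v ≤ lev u + 1
  exists_parent : ∀ v, lev v ≠ 0 → ∃ p, G.Adj p v ∧ lev p + 1 = lev v
  lev_between : ∀ u z v, G.Adj u v → u < z → z < v → lev u < lev z ∨ lev v < lev z

variable {N : ℕ} {G : SimpleGraph (Fin N)} {lev : Fin N → ℕ}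

/-- The edges from a level to the next one do not cross. -/
theorem IsLeveled.parent_mono (h : G.IsLeveled lev) {p d p' d' : Fin N} (hpd : G.Adj p d)
    (hpd' : G.Adj p' d') (hl : lev p + 1 = lev d) (hl' : lev p' + 1 = lev d')
    (hd : lev d = lev d') (hlt : d < d') : p ≤ p' := by
  by_contra! hp
  have h₁ : ¬ p < d' := fun hlt' => by
    rcases h.lev_between p' p d' hpd' hp hlt' <;> omega
  have h₂ : ¬ d < p' := fun hlt' => by
    rcases h.lev_between d p' p hpd.symm hlt' hp <;> omega
  have h₃ : p ≠ d' := by rintro rfl; omega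
  have h₄ : d ≠ p' := by rintro rfl; omega
  exact h.noncrossing p' d d' p (by omega) hlt (by omega) hpd' hpd.symm

/-- The neighbours of a vertex on the previous level are consecutive. -/
theorem IsLeveled.parents_consecutive (h : G.IsLeveled lev) {p c q d : Fin N} (hpd : G.Adj p d)
    (hqd : G.Adj q d) (hp : lev p + 1 = lev d) (hq : lev q + 1 = lev d) (hc : lev c + 1 = lev d)
    (hpc : p < c) (hcq : c < q) : False := by
  have hcd : c ≠ d := by rintro rfl; omega
  rcases lt_or_gt_of_ne hcd with hlt | hlt
  · rcases h.lev_between p c d hpd hpc hlt <;> omega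
  · rcases h.lev_between d c q hqd.symm hlt hcq <;> omega

theorem IsLeveled.siblings_consecutive (h : G.IsLeveled lev) {u z v : Fin N} (huv : G.Adj u v)
    (hl : lev u = lev v) (hz : lev z = lev u) (huz : u < z) (hzv : z < v) : False := by
  rcases h.lev_between u z v huv huz hzv <;> omega

theorem IsLeveled.hasUnitGridCoordinates (h : G.IsLeveled lev) : HasUnitGridCoordinates G := by
  classical
  let P : Fin N → Set (Fin N) := fun v => {p | G.Adj p v ∧ lev p + 1 = lev v}
  have hP : ∀ v, lev v ≠ 0 → (P v).Nonempty := h.exists_parent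
  have hfp : ∀ v, ∃ p, lev v ≠ 0 → p ∈ P v ∧ ∀ q ∈ P v, p ≤ q := fun v => by
    by_cases hv : lev v = 0
    · exact ⟨v, fun h' => (h' hv).elim⟩
    · obtain ⟨p, hp, hmin⟩ := Set.exists_min_image (P v) id (Set.toFinite _) (hP v hv)
      exact ⟨p, fun _ => ⟨hp, hmin⟩⟩
  have hlp : ∀ v, ∃ p, lev v ≠ 0 → p ∈ P v ∧ ∀ q ∈ P v, q ≤ p := fun v => by
    by_cases hv : lev v = 0
    · exact ⟨v, fun h' => (h' hv).elim⟩
    · obtain ⟨p, hp, hmax⟩ := Set.exists_max_image (P v) id (Set.toFinite _) (hP v hv)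
      exact ⟨p, fun _ => ⟨hp, hmax⟩⟩
  choose fp hfp using hfp
  choose lp hlp using hlp
  -- In ξ each vertex lies just below its first parent `fp`. In η, obtained from the reversed order
  -- and reflected, it lies just above its last parent `lp`.
  obtain ⟨ξ, ξb, ξlt, ξpar, ξlow⟩ := exists_postorder (fun v : Fin N => (v : ℕ)) lev fp (N + 1)
    Fin.val_injective (fun v => by omega) (fun v hv => (hfp v hv).1.2)
    (fun v w hvw hv hlt => h.parent_mono (hfp v hv).1.1 (hfp w (hvw ▸ hv)).1.1 (hfp v hv).1.2
      (hfp w (hvw ▸ hv)).1.2 hvw hlt)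
  obtain ⟨η', ηb, ηlt, ηpar, ηlow⟩ := exists_postorder (fun v : Fin N => (v.rev : ℕ)) lev lp (N + 1)
    (Fin.val_injective.comp Fin.rev_injective) (fun v => by omega) (fun v hv => (hlp v hv).1.2)
    (fun v w hvw hv hlt => Fin.rev_le_rev.2 (h.parent_mono (hlp w (hvw ▸ hv)).1.1 (hlp v hv).1.1
      (hlp w (hvw ▸ hv)).1.2 (hlp v hv).1.2 hvw.symm (Fin.rev_lt_rev.1 hlt)))
  obtain ⟨η, rfl⟩ : ∃ η : Fin N → ℝ, η' = fun v => 1 / 4 - η v :=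
    ⟨fun v => 1 / 4 - η' v, by ext v; ring⟩
  replace ξlt : ∀ v w, lev v = lev w → v < w → ξ v < ξ w := ξlt
  replace ξlow : ∀ v w, lev v ≠ 0 → lev w = lev (fp v) → w < fp v → ξ w < ξ v := ξlow
  replace ηb : ∀ v, 0 < η v ∧ η v < 1 / 4 := fun v => by
    have := ηb v; constructor <;> linarith
  replace ηlt : ∀ v w, lev v = lev w → v < w → η v < η w := fun v w hvw hlt => by
    have := ηlt w v hvw.symm (Fin.rev_lt_rev.2 hlt); linarith
  replace ηpar : ∀ v, lev v ≠ 0 → η (lp v) < η v := fun v hv => by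
    have := ηpar v hv; linarith
  replace ηlow : ∀ v w, lev v ≠ 0 → lev w = lev (lp v) → lp v < w → η v < η w :=
    fun v w hv hw hlt => by
      have := ηlow v w hv hw (Fin.rev_lt_rev.2 hlt); linarith
  have ξle : ∀ v w, lev v = lev w → v ≤ w → ξ v ≤ ξ w := fun v w hvw hle => by
    rcases hle.eq_or_lt with rfl | hlt
    · exact le_rfl
    · exact (ξlt v w hvw hlt).le
  have ηle : ∀ v w, lev v = lev w → v ≤ w → η v ≤ η w := fun v w hvw hle => by
    rcases hle.eq_or_lt with rfl | hlt
    · exact le_rfl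
    · exact (ηlt v w hvw hlt).le
  -- the offsets of the edges between consecutive levels
  have hlam : ∀ c d, ∃ m, G.Adj c d → lev c + 1 = lev d → (ξ d < m ∧ m < ξ c) ∧
      (∀ v, lev v = lev c → v < c → ξ v < m) ∧ ∀ v, lev v = lev d → d < v → m < ξ v := by
    intro c d
    by_cases hcd : G.Adj c d ∧ lev c + 1 = lev d
    swap
    · exact ⟨0, fun h1 h2 => (hcd ⟨h1, h2⟩).elim⟩
    obtain ⟨hadj, hl⟩ := hcd
    have hd : lev d ≠ 0 := by omega
    obtain ⟨m, h1, h2, -⟩ := exists_between_avoiding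
      (insert (ξ d) (ξ '' {v | lev v = lev c ∧ v < c}))
      (insert (ξ c) (ξ '' {v | lev v = lev d ∧ d < v})) ∅ (Set.toFinite _) (Set.toFinite _)
      Set.finite_empty (by
        have hle := (hfp d hd).2 c ⟨hadj, hl⟩
        have hlf := (hfp d hd).1.2
        rintro _ (rfl | ⟨v, ⟨hv, hvc⟩, rfl⟩) _ (rfl | ⟨w, ⟨hw, hdw⟩, rfl⟩)
        · exact (ξpar d hd).trans_le (ξle _ _ (by omega) hle)
        · exact ξlt _ _ hw.symm hdw
        · exact ξlt _ _ hv hvc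
        -- Since w comes after d, its first parent is not before c, hence is after v.
        · have hw0 : lev w ≠ 0 := by omega
          have hlw := (hfp w hw0).1.2
          exact ξlow w v hw0 (by omega) (hvc.trans_le
            (h.parent_mono hadj (hfp w hw0).1.1 hl hlw hw.symm hdw)))
    exact ⟨m, fun _ _ => ⟨⟨h1 _ (Or.inl rfl), h2 _ (Or.inl rfl)⟩,
      fun v hv hvc => h1 _ (Or.inr ⟨v, ⟨hv, hvc⟩, rfl⟩),
      fun v hv hvc => h2 _ (Or.inr ⟨v, ⟨hv, hvc⟩, rfl⟩)⟩⟩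
  have htau : ∀ c d, ∃ m, G.Adj c d → lev c + 1 = lev d → (η c < m ∧ m < η d) ∧
      (∀ v, lev v = lev d → v < d → η v < m) ∧ ∀ v, lev v = lev c → c < v → m < η v := by
    intro c d
    by_cases hcd : G.Adj c d ∧ lev c + 1 = lev d
    swap
    · exact ⟨0, fun h1 h2 => (hcd ⟨h1, h2⟩).elim⟩
    obtain ⟨hadj, hl⟩ := hcd
    have hd : lev d ≠ 0 := by omega
    obtain ⟨m, h1, h2, -⟩ := exists_between_avoiding
      (insert (η c) (η '' {v | lev v = lev d ∧ v < d}))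
      (insert (η d) (η '' {v | lev v = lev c ∧ c < v})) ∅ (Set.toFinite _) (Set.toFinite _)
      Set.finite_empty (by
        have hle := (hlp d hd).2 c ⟨hadj, hl⟩
        have hlf := (hlp d hd).1.2
        rintro _ (rfl | ⟨v, ⟨hv, hvc⟩, rfl⟩) _ (rfl | ⟨w, ⟨hw, hdw⟩, rfl⟩)
        · exact (ηle _ _ (by omega) hle).trans_lt (ηpar d hd)
        · exact ηlt _ _ hw.symm hdw
        · exact ηlt _ _ hv hvc
        · have hv0 : lev v ≠ 0 := by omega
          have hlv := (hlp v hv0).1.2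
          exact ηlow v w hv0 (by omega)
            ((h.parent_mono (hlp v hv0).1.1 hadj hlv hl hv hvc).trans_lt hdw))
    exact ⟨m, fun _ _ => ⟨⟨h1 _ (Or.inl rfl), h2 _ (Or.inl rfl)⟩,
      fun v hv hvc => h1 _ (Or.inr ⟨v, ⟨hv, hvc⟩, rfl⟩),
      fun v hv hvc => h2 _ (Or.inr ⟨v, ⟨hv, hvc⟩, rfl⟩)⟩⟩
  choose lam hlam using hlam
  choose tau htau using htau
  -- the vertical offsets of the edges inside a level
  have hsig : ∀ c d, ∃ m, G.Adj c d → lev c = lev d → c < d → (η d < m ∧ m < 1 / 4) ∧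
      (∀ v, lev v = lev c + 1 → ξ v ≤ ξ c → η v < m) ∧ (∀ v, lev v = lev d → d < v → m < η v) ∧
      ∀ u v, m ≠ tau u v := by
    intro c d
    by_cases hcd : G.Adj c d ∧ lev c = lev d ∧ c < d
    swap
    · exact ⟨0, fun h1 h2 h3 => (hcd ⟨h1, h2, h3⟩).elim⟩
    obtain ⟨hadj, hl, hlt⟩ := hcd
    obtain ⟨m, h1, h2, h3⟩ := exists_between_avoiding
      (insert (η d) (η '' {v | lev v = lev c + 1 ∧ ξ v ≤ ξ c}))
      (insert (1 / 4) (η '' {v | lev v = lev d ∧ d < v})) (Set.range fun q : Fin N × Fin N =>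
        tau q.1 q.2) (Set.toFinite _) (Set.toFinite _) (Set.toFinite _) (by
        rintro _ (rfl | ⟨v, ⟨hv, hvc⟩, rfl⟩) _ (rfl | ⟨w, ⟨hw, hdw⟩, rfl⟩)
        · exact (ηb d).2
        · exact ηlt _ _ hw.symm hdw
        · exact (ηb v).2
        · have hv0 : lev v ≠ 0 := by omega
          have hlf := (hfp v hv0).1.2
          have hll := (hlp v hv0).1.2
          -- The condition ξ v ≤ ξ c puts the first parent of v at or before c. As d cannot lie
          -- strictly between two parents of v, the last parent is at or before d, which bounds η v.
          have hfc : fp v ≤ c := not_lt.1 fun h' => by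
            have := ξlow v c hv0 (by omega) h'
            linarith
          have hld : lp v ≤ d := not_lt.1 fun h' =>
            h.parents_consecutive (hfp v hv0).1.1 (hlp v hv0).1.1 hlf hll (c := d) (by omega)
              (hfc.trans_lt hlt) h'
          exact ηlow v w hv0 (by omega) (hld.trans_lt hdw))
    exact ⟨m, fun _ _ _ => ⟨⟨h1 _ (Or.inl rfl), h2 _ (Or.inl rfl)⟩,
      fun v hv hvc => h1 _ (Or.inr ⟨v, ⟨hv, hvc⟩, rfl⟩),
      fun v hv hvc => h2 _ (Or.inr ⟨v, ⟨hv, hvc⟩, rfl⟩), fun u v huv => h3 ⟨(u, v), huv.symm⟩⟩⟩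
  choose sig hsig using hsig
  have horient : ∀ e : G.edgeSet, ∃ c d, (e : Sym2 (Fin N)) = s(c, d) ∧ G.Adj c d ∧
      (lev c + 1 = lev d ∨ lev c = lev d ∧ c < d) := by
    rintro ⟨e, he⟩
    induction e using Sym2.ind with
    | _ u v =>
      have h1 := h.lev_adj u v he
      have h2 := h.lev_adj v u he.symm
      have hne := G.ne_of_adj he
      rcases lt_trichotomy (lev u) (lev v) with hlt | heq | hlt
      · exact ⟨u, v, rfl, he, Or.inl (by omega)⟩
      · rcases lt_or_gt_of_ne hne with hlt | hlt
        · exact ⟨u, v, rfl, he, Or.inr ⟨heq, hlt⟩⟩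
        · exact ⟨v, u, Sym2.eq_swap, he.symm, Or.inr ⟨heq.symm, hlt⟩⟩
      · exact ⟨v, u, Sym2.eq_swap, he.symm, Or.inl (by omega)⟩
  choose s t hst hadj hlev using horient
  let a : G.edgeSet → ℝ := fun e =>
    lev (s e) + if lev (s e) = lev (t e) then ξ (s e) else lam (s e) (t e)
  let β : G.edgeSet → ℝ := fun e =>
    if lev (s e) = lev (t e) then sig (s e) (t e) else tau (s e) (t e)
  have hβ : ∀ e, 0 < β e ∧ β e < 1 / 4 := by
    intro e
    rcases hlev e with hl | ⟨hl, hlt⟩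
    · have hne : lev (s e) ≠ lev (t e) := by omega
      have h1 := (htau _ _ (hadj e) hl).1
      have := ηb (s e); have := ηb (t e)
      simp only [β, hne, if_false]
      constructor <;> linarith
    · have h1 := (hsig _ _ (hadj e) hl hlt).1
      have := ηb (t e)
      simp only [β, hl, if_true]
      constructor <;> linarith
  have hlev_eq : ∀ {j k : ℕ} {p q : ℝ}, 0 < p → p < 1 / 4 → 0 < q → q < 1 / 4 →
      (j : ℝ) + p = k + q → j = k := by
    intro j k p q hp hp' hq hq' hjk
    have h1 : (j : ℝ) < k + 1 := by linarith
    have h2 : (k : ℝ) < j + 1 := by linarith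
    have h1' : j < k + 1 := by exact_mod_cast h1
    have h2' : k < j + 1 := by exact_mod_cast h2
    omega
  refine ⟨fun v => lev v + ξ v, fun v => -lev v + η v, a, fun e => -lev (s e) + β e, ?_, ?_, ?_⟩
  · intro v w hvw
    have hl := hlev_eq (ξb v).1 (ξb v).2 (ξb w).1 (ξb w).2 hvw
    simp only [hl, add_right_inj] at hvw
    rcases lt_trichotomy v w with h' | h' | h'
    · have := ξlt v w hl h'; linarith
    · exact h'
    · have := ξlt w v hl.symm h'; linarith
  · intro e f hef
    simp only at hef
    have hl : lev (s e) = lev (s f) := by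
      refine (hlev_eq (hβ e).1 (hβ e).2 (hβ f).1 (hβ f).2 ?_ : lev (s f) = lev (s e)).symm
      linarith
    have hb : β e = β f := by rw [hl] at hef; linarith
    suffices hse : s e = s f ∧ t e = t f by
      apply Subtype.ext
      rw [hst e, hst f, hse.1, hse.2]
    -- Edges of different kinds differ in height because `sig` avoids all values of `tau`. Within
    -- one kind, the η-value of an end separates the heights.
    have key : ∀ e f, lev (s e) = lev (s f) → β e = β f → ¬ t e < t f ∧ (t e = t f → ¬ s e < s f) := by
      intro e f hl hb
      rcases hlev e with he | ⟨he, he'⟩ <;> rcases hlev f with hf | ⟨hf, hf'⟩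
      · have hne : lev (s e) ≠ lev (t e) := by omega
        have hnf : lev (s f) ≠ lev (t f) := by omega
        simp only [β, hne, hnf, if_false] at hb
        obtain ⟨e1, e2, e3⟩ := htau _ _ (hadj e) he
        obtain ⟨f1, f2, f3⟩ := htau _ _ (hadj f) hf
        refine ⟨fun hlt => ?_, fun _ hlt => ?_⟩
        · have := f2 (t e) (by omega) hlt; linarith
        · have := e3 (s f) hl.symm hlt; linarith
      · have hne : lev (s e) ≠ lev (t e) := by omega
        simp only [β, hne, hf, if_false, if_true] at hb
        exact ((hsig _ _ (hadj f) hf hf').2.2.2 _ _ hb.symm).elim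
      · have hnf : lev (s f) ≠ lev (t f) := by omega
        simp only [β, hnf, he, if_false, if_true] at hb
        exact ((hsig _ _ (hadj e) he he').2.2.2 _ _ hb).elim
      · simp only [β, he, hf, if_true] at hb
        obtain ⟨e1, e2, e3, -⟩ := hsig _ _ (hadj e) he he'
        obtain ⟨f1, f2, f3, -⟩ := hsig _ _ (hadj f) hf hf'
        refine ⟨fun hlt => ?_, fun heq hlt => ?_⟩
        · have := e3 (t f) (by omega) hlt; linarith
        · exact h.siblings_consecutive (hadj e) he hl.symm hlt (heq ▸ hf')
    have k1 := key e f hl hb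
    have k2 := key f e hl.symm hb.symm
    have ht : t e = t f := le_antisymm (not_lt.1 k2.1) (not_lt.1 k1.1)
    exact ⟨le_antisymm (not_lt.1 (k2.2 ht.symm)) (not_lt.1 (k1.2 ht)), ht⟩
  · intro v e
    rw [hst e, Sym2.mem_iff]
    have hξ := ξb v
    have hη := ηb v
    have cases_lev : (lev v : ℝ) + 1 ≤ lev (s e) ∨ lev v = lev (s e) ∨ lev v = lev (s e) + 1 ∨
        (lev (s e) : ℝ) + 2 ≤ lev v := by
      rcases lt_trichotomy (lev v) (lev (s e)) with h' | h' | h'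
      · exact Or.inl (by exact_mod_cast h')
      · exact Or.inr (Or.inl h')
      · rcases (Nat.succ_le_of_lt h').eq_or_lt with h'' | h''
        · exact Or.inr (Or.inr (Or.inl h''.symm))
        · exact Or.inr (Or.inr (Or.inr (by exact_mod_cast h'')))
    rcases hlev e with hl | ⟨hl, hlt⟩
    · have hne : lev (s e) ≠ lev (t e) := by omega
      obtain ⟨⟨l1, l2⟩, l3, l4⟩ := hlam _ _ (hadj e) hl
      obtain ⟨⟨t1, t2⟩, t3, t4⟩ := htau _ _ (hadj e) hl
      have bs := ξb (s e)
      have bt := ξb (t e)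
      have cs := ηb (s e)
      have ct := ηb (t e)
      simp only [a, β, hne, if_false]
      constructor
      · rintro (rfl | rfl)
        · exact ⟨⟨by linarith, by linarith⟩, by linarith, by linarith⟩
        · have hr : (lev (t e) : ℝ) = lev (s e) + 1 := by exact_mod_cast hl.symm
          rw [hr]
          exact ⟨⟨by linarith, by linarith⟩, by linarith, by linarith⟩
      · rintro ⟨⟨x1, x2⟩, y1, y2⟩
        rcases cases_lev with hv | hv | hv | hv
        · linarith
        -- On the lower level, vertices before `s e` lie too far left and those after it too high.
        -- On the upper level, vertices before `t e` end too low and those after it lie too far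
        -- right.
        · rw [hv] at x1 x2 y1 y2
          rcases lt_trichotomy v (s e) with h' | h' | h'
          · have := l3 v hv h'; linarith
          · exact Or.inl h'
          · have := t4 v hv h'; linarith
        · have hr : (lev v : ℝ) = lev (s e) + 1 := by exact_mod_cast hv
          rw [hr] at x1 x2 y1 y2
          rcases lt_trichotomy v (t e) with h' | h' | h'
          · have := t3 v (by omega) h'; linarith
          · exact Or.inr h'
          · have := l4 v (by omega) h'; linarith
        · linarith
    · obtain ⟨⟨t1, t2⟩, t3, t4, -⟩ := hsig _ _ (hadj e) hl hlt
      have bs := ξb (s e)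
      have bt := ξb (t e)
      have cs := ηb (s e)
      have ct := ηb (t e)
      have lt₁ := ξlt _ _ hl hlt
      have lt₂ := ηlt _ _ hl hlt
      simp only [a, β, hl, if_true]
      rw [hl] at cases_lev
      constructor
      · rintro (rfl | rfl)
        · rw [hl]
          exact ⟨⟨by linarith, by linarith⟩, by linarith, by linarith⟩
        · exact ⟨⟨by linarith, by linarith⟩, by linarith, by linarith⟩
      · rintro ⟨⟨x1, x2⟩, y1, y2⟩
        rcases cases_lev with hv | hv | hv | hv
        · linarith
        · rw [hv] at x1 x2 y1 y2
          rcases lt_trichotomy v (s e) with h' | h' | h'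
          · have := ξlt v (s e) (by omega) h'; linarith
          · exact Or.inl h'
          · rcases lt_trichotomy v (t e) with h'' | h'' | h''
            · exact (h.siblings_consecutive (hadj e) hl (by omega) h' h'').elim
            · exact Or.inr h''
            · have := t4 v hv h''; linarith
        -- Vertices of the next level that the edge reaches horizontally satisfy ξ v ≤ ξ (s e). The
        -- choice of `sig` puts the edge above their upper ends.
        · have hr : (lev v : ℝ) = lev (t e) + 1 := by exact_mod_cast hv
          rw [hr] at x1 x2 y1 y2
          have := t3 v (by omega) (by linarith)
          linarith
        · linarith

/-- The distance from the first vertex is a level function of a connected crossing-free graph. -/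
theorem isLeveled_dist {n : ℕ} {G : SimpleGraph (Fin (n + 1))} (hG : G.Connected)
    (hnc : ∀ a b c d, a < b → b < c → c < d → G.Adj a c → G.Adj b d → False) :
    G.IsLeveled (G.dist 0) := by
  have hpar : ∀ v, G.dist 0 v ≠ 0 → ∃ p, G.Adj p v ∧ G.dist 0 p + 1 = G.dist 0 v := by
    intro v hv
    obtain ⟨w, hw⟩ := hG.exists_walk_length_eq_dist v 0
    cases w with
    | nil => simp at hv
    | @cons _ p _ hadj q =>
      refine ⟨p, hadj.symm, ?_⟩
      have h1 := G.dist_le q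
      have h2 := hG.dist_triangle (u := 0) (v := p) (w := v)
      have h3 := (G.dist_eq_one_iff_adj).2 hadj.symm
      rw [Walk.length_cons] at hw
      rw [G.dist_comm (u := 0) (v := v), G.dist_comm (u := 0) (v := p)] at *
      omega
  refine ⟨hnc, fun u v huv => ?_, hpar, ?_⟩
  · have h2 := hG.dist_triangle (u := 0) (v := u) (w := v)
    have h3 := (G.dist_eq_one_iff_adj).2 huv
    omega
  -- Vertex 0 is not strictly beneath the edge uv, so a shortest path from 0 to z must pass through
  -- u or v: by noncrossing, a parent of z lies between u and v or is one of them.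
  · have key : ∀ k z, G.dist 0 z = k → ∀ u v, G.Adj u v → u < z → z < v →
        G.dist 0 u < G.dist 0 z ∨ G.dist 0 v < G.dist 0 z := by
      intro k
      induction k with
      | zero =>
        intro z hz u v _ hu _
        rw [← (hG.dist_eq_zero_iff).1 hz] at hu
        exact absurd hu (Fin.not_lt_zero u)
      | succ k ih =>
        intro z hz u v huv hu hv
        obtain ⟨p, hpz, hp⟩ := hpar z (by omega)
        rcases lt_trichotomy p u with h1 | h1 | h1
        · exact (hnc p u z v h1 hu hv hpz huv).elim
        · subst h1; left; omega
        · rcases lt_trichotomy p v with h2 | h2 | h2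
          · rcases ih p (by omega) u v huv h1 h2 with h3 | h3
            · left; omega
            · right; omega
          · subst h2; right; omega
          · exact (hnc u z v p hu hv h2 huv hpz.symm).elim
    exact fun u z v huv hu hv => key _ z rfl u v huv hu hv

/-- A graph with a crossing-free vertex order has a unit grid representation. -/
theorem IsLayout.hasUnitGridCoordinates {V : Type*} [Finite V] {G : SimpleGraph V} {T : Set V}
    {f : V → ℤ} (hf : G.IsLayout Set.univ T f) : HasUnitGridCoordinates G := by
  have hinj : Function.Injective f := Set.injOn_univ.1 hf.injOn
  let _ : LinearOrder V := LinearOrder.lift' f hinj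
  have flt : ∀ {a b : V}, a < b → f a < f b := fun h => h
  let _ := Fintype.ofFinite V
  rcases hN : Fintype.card V with _ | n
  · have := Fintype.card_eq_zero_iff.1 hN
    refine ⟨isEmptyElim, isEmptyElim, fun _ => 0, fun _ => 0, fun v => isEmptyElim v, fun e => ?_,
      fun v => isEmptyElim v⟩
    exact isEmptyElim (Quot.out (e : Sym2 V)).1
  let φ : Fin (n + 1) ≃o V := monoEquivOfFin V hN
  -- An edge between consecutive vertices crosses nothing, so connectedness comes for free.
  let H : SimpleGraph (Fin (n + 1)) := G.comap φ ⊔ pathGraph (n + 1)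
  have hH : H.Connected := (pathGraph_connected n).mono le_sup_right
  refine (isLeveled_dist hH ?_).hasUnitGridCoordinates.of_embedding φ.symm φ.symm.injective ?_
  · rintro a b c d hab hbc hcd (hac | hac) (hbd | hbd)
    · exact hf.noncrossing _ trivial _ trivial _ trivial _ trivial (flt (φ.strictMono hab))
        (flt (φ.strictMono hbc)) (flt (φ.strictMono hcd)) hac hbd
    all_goals
      simp only [pathGraph_adj] at *
      omega
  · intro u v huv
    exact Or.inl (by simpa using huv)

end SimpleGraph

theorem mainTheorem12 {V : Type*} [Finite V] (G : SimpleGraph V) (hG : IsOuterplanar G) :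
    IsUGIG (comparabilityGraph (IncidencePoset G)) := by
  -- With W empty there is nothing to expose, and only the crossing-free order remains.
  obtain ⟨f, hf⟩ := hG.outerMinorFree.exists_layout Set.univ ∅ (by simp [SimpleGraph.IsLinked])
    (Set.empty_disjoint _)
  exact hf.hasUnitGridCoordinates.isUGIG
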